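/- Let $E$ be a measurable space, $\partial\notin E$, and let $(X_t)_{t\ge 0}$ be a (jointly measurable) time-homogeneous Markov process on $E\cup\{\partial\}$, with laws $\mathbb P_x$ and $\mathbb P_\mu=\int_E\mathbb P_x\,\mu(dx)$, which is absorbed in $\partial$ at time $\tau_\partial=\inf\{t\ge 0: X_t=\partial\}$. Assume that, for all $x\in E$, $\tau_\partial<\infty$ $\mathbb P_x$-a.s. and $\mathbb P_x(t<\tau_\partial)>0$ for all $t\ge 0$. Let $\mathcal M_1(E)$ be the set of probability measures on $E$ and $\mathcal B_b(E)$ the set of bounded measurable functions $E\to\mathbb R$ with the sup norm $\|\cdot\|_\infty$, and write $\|\mu_1-\mu_2\|_{TV}=\sup\{|\mu_1(f)-\mu_2(f)|: f\in\mathcal B_b(E),\ \|f\|_\infty\le 1\}$. Assume that there are a probability measure $\nu$ on $E$ and constants $t_0,c_1,c_2>0$ such that $$\text{(A1)}\quad \mathbb P_x(X_{t_0}\in\cdot\mid t_0<\tau_\partial)\ge c_1\nu\quad\forall x\in E,\qquad \text{(A2)}\quad \mathbb P_\nu(t<\tau_\partial)\ge c_2\,\mathbb P_x(t<\tau_\partial)\quad\forall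 t\ge 0,\ x\in E.$$ Put $P_tf(x)=\mathbb E_x[f(X_t)\mathbf 1_{t<\tau_\partial}]$. Then the Green operator $Af(x)=\int_0^\infty P_sf(x)\,ds$ is well defined and bounded on $\mathcal B_b(E)$, so that $e^{tA}=\sum_{n\ge0}\frac{t^n}{n!}A^n$ is well defined. Moreover there exist a quasi-stationary distribution $\alpha\in\mathcal M_1(E)$ (that is, $\mathbb P_\alpha(X_t\in\cdot\mid t<\tau_\partial)=\alpha$ for all $t\ge0$), a bounded measurable function $\eta:E\to[0,\infty)$ with $\alpha(\eta)=1$, constants $\lambda_0,\gamma,C>0$, and constants $C',C''$ such that, for all $t\ge0$, $x\in E$ and $\mu\in\mathcal M_1(E)$, $$(*)\quad \begin{aligned}&\mathbb P_\alpha(t<\tau_\partial)=e^{-\lambda_0t},&&\|\mathbb P_\mu(X_t\in\cdot\mid t<\tau_\partial)-\alpha\|_{TV}\le Ce^{-\gamma t},\\ &|e^{\lambda_0t}\mathbb P_x(t<\tau_\partial)-\eta(x)|\le C'e^{-\gamma t},&&\mathbb P_x(t<\tau_\partial)\le C''e^{-\lambda_0t}.\end{aligned}$$ For every such choice of $\alpha,\eta,\lambda_0,\gamma,C,C',C''$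 the following holds. For all $\mu\in\mathcal M_1(E)$, $f\in\mathcal B_b(E)$ and $n\ge1$, $$\left|\mu A^nf-\frac{\alpha(f)\,\mu(\eta)}{\lambda_0^n}\right|\le\frac{(CC''+C')\,\|f\|_\infty}{(\lambda_0+\gamma)^n}.$$ Moreover there is a constant $B$ such that, for all $\mu\in\mathcal M_1(E)$, $\mu(\eta)>0$ and $$\left\|\frac{\mu A^n}{\mu A^n\mathbf 1}-\alpha\right\|_{TV}\le\frac{B}{\mu(\eta)}\left(\frac{\lambda_0}{\lambda_0+\gamma}\right)^n\ \ (n\ge1),\qquad \left\|\frac{\mu e^{tA}}{\mu e^{tA}\mathbf 1}-\alpha\right\|_{TV}\le\frac{B}{\mu(\eta)}\,e^{-t\frac{\gamma}{\lambda_0(\lambda_0+\gamma)}}\ \ (t\ge0),$$ where the normalizing factors $\mu A^n\mathbf 1$ and $\mu e^{tA}\mathbf 1$ are positive. -/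

import Mathlib

open MeasureTheory ProbabilityTheory
open scoped NNReal ENNReal

noncomputable section

/-- The state space `E ∪ {∂}`, with the measurable structure of the disjoint union. -/
abbrev WithCemetery (E : Type*) := E ⊕ Unit

/-- The cemetery point `∂`. -/
abbrev cemetery {E : Type*} : WithCemetery E := Sum.inr ()

/-- The absorption time `τ_∂ = inf {t ≥ 0 : X_t = ∂}`, with `inf ∅ = ∞`. -/
def absorptionTime {E Ω : Type*} (X : ℝ≥0 → Ω → WithCemetery E) (ω : Ω) : ℝ≥0∞ :=
  ⨅ (t : ℝ≥0) (_ : X t ω = cemetery), (t : ℝ≥0∞)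

/-- A time-homogeneous Markov process on `E ∪ {∂}`, absorbed in `∂` at time `τ_∂`. -/
structure AbsorbedMarkovProcess (E Ω : Type*) [MeasurableSpace E] [mΩ : MeasurableSpace Ω] where
  /-- the process `(X_t)_{t ≥ 0}` -/
  X : ℝ≥0 → Ω → WithCemetery E
  /-- the filtration with respect to which it is Markov -/
  ℱ : Filtration ℝ≥0 mΩ
  /-- the family `(ℙ_x)`, `x ∈ E ∪ {∂}`, depending measurably on `x` -/
  law : Kernel (WithCemetery E) Ω
  isMarkovKernel : IsMarkovKernel law
  measurable : Measurable (fun p : ℝ≥0 × Ω => X p.1 p.2)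
  adapted : ∀ t, Measurable[ℱ t] (X t)
  /-- under `ℙ_x` the law of `X_0` is `δ_x` -/
  start : ∀ x, (law x).map (X 0) = Measure.dirac x
  /-- `ℙ_x(X_{t+s} ∈ B | ℱ_t) = ℙ_{X_t}(X_s ∈ B)`, `ℙ_x`-almost surely -/
  markov : ∀ (x : WithCemetery E) (t s : ℝ≥0) (F : Set Ω) (B : Set (WithCemetery E)),
    MeasurableSet[ℱ t] F → MeasurableSet B →
      law x (F ∩ X (t + s) ⁻¹' B) = ∫⁻ ω in F, law (X t ω) (X s ⁻¹' B) ∂(law x)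
  /-- from time `τ_∂` on, the process stays in `∂`, almost surely for every initial law `m`
  (not only for every starting point, as the event in question need not be measurable) -/
  absorbed : ∀ m : Measure (WithCemetery E), IsProbabilityMeasure m →
    ∀ᵐ ω ∂(m.bind law), ∀ t : ℝ≥0, absorptionTime X ω ≤ t → X t ω = cemetery

/-- `f ∈ 𝓑_b(E)`: bounded and measurable. -/
def IsBddMeas {E : Type*} [MeasurableSpace E] (f : E → ℝ) : Prop :=
  Measurable f ∧ ∃ M : ℝ, ∀ x, |f x| ≤ M

/-- `‖f‖_∞`, for bounded `f`. -/
def supNorm {E : Type*} (f : E → ℝ) : ℝ := ⨆ x, |f x|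

/-- `‖μ₁ - μ₂‖_TV = sup {|μ₁(f) - μ₂(f)| : f ∈ 𝓑_b(E), ‖f‖_∞ ≤ 1}`, a finite signed measure being
given by the linear form `f ↦ μ(f)`. The supremum is taken in `[0, ∞]`. -/
def tvDist {E : Type*} [MeasurableSpace E] (Φ Ψ : (E → ℝ) → ℝ) : ℝ≥0∞ :=
  ⨆ (f : E → ℝ) (_ : Measurable f ∧ ∀ x, |f x| ≤ 1), ENNReal.ofReal |Φ f - Ψ f|

/-- The linear form `f ↦ μ(f)`. -/
def toForm {E : Type*} [MeasurableSpace E] (μ : Measure E) (f : E → ℝ) : ℝ := ∫ x, f x ∂μ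

namespace AbsorbedMarkovProcess

variable {E Ω : Type*} [MeasurableSpace E] [MeasurableSpace Ω] (𝕏 : AbsorbedMarkovProcess E Ω)

/-- `τ_∂` -/
def τ (ω : Ω) : ℝ≥0∞ := absorptionTime 𝕏.X ω

/-- `ℙ_x` for `x ∈ E` -/
def pr (x : E) : Measure Ω := 𝕏.law (Sum.inl x)

/-- `ℙ_μ = ∫ ℙ_x μ(dx)` for a measure `μ` on `E` -/
def prInit (μ : Measure E) : Measure Ω := (μ.map Sum.inl).bind 𝕏.law

/-- `Q(t < τ_∂)` -/
def survival (Q : Measure Ω) (t : ℝ≥0) : ℝ := Q.real {ω | (t : ℝ≥0∞) < 𝕏.τ ω}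

/-- The measure `Q(X_t ∈ · | t < τ_∂)` on `E`. -/
def condLaw (Q : Measure Ω) (t : ℝ≥0) : Measure E :=
  ((ProbabilityTheory.cond Q {ω | (t : ℝ≥0∞) < 𝕏.τ ω}).map (𝕏.X t)).comap Sum.inl

/-- `α` is a quasi-stationary distribution. -/
def IsQuasiStationary (α : Measure E) : Prop :=
  IsProbabilityMeasure α ∧ ∀ t, 𝕏.condLaw (𝕏.prInit α) t = α

/-- `P_t f(x) = 𝔼_x[f(X_t) 1_{t < τ_∂}]`. -/
def semigroup (t : ℝ≥0) (f : E → ℝ) (x : E) : ℝ :=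
  ∫ ω, Set.indicator {ω | (t : ℝ≥0∞) < 𝕏.τ ω} (fun ω => Sum.elim f (fun _ => 0) (𝕏.X t ω)) ω
    ∂(𝕏.pr x)

/-- The Green operator `A f(x) = ∫_0^∞ P_s f(x) ds`. -/
def green (f : E → ℝ) (x : E) : ℝ :=
  ∫ s in Set.Ioi (0 : ℝ), 𝕏.semigroup s.toNNReal f x

/-- `μ A^n f` -/
def greenPow (μ : Measure E) (n : ℕ) (f : E → ℝ) : ℝ := ∫ x, (𝕏.green^[n] f) x ∂μ

/-- `e^{tA} f(x) = ∑_n t^n / n! A^n f(x)` -/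
def expGreen (t : ℝ) (f : E → ℝ) (x : E) : ℝ :=
  ∑' n : ℕ, t ^ n / (n.factorial : ℝ) * (𝕏.green^[n] f) x

/-- `μ e^{tA} f` -/
def greenExp (μ : Measure E) (t : ℝ) (f : E → ℝ) : ℝ := ∫ x, 𝕏.expGreen t f x ∂μ

/-- Condition (A1) for `ν, t₀, c₁`: `ℙ_x(X_{t₀} ∈ · | t₀ < τ_∂) ≥ c₁ ν` for all `x ∈ E`. -/
def CondA1 (ν : Measure E) (t₀ : ℝ≥0) (c₁ : ℝ) : Prop :=
  ∀ x, ENNReal.ofReal c₁ • ν ≤ 𝕏.condLaw (𝕏.pr x) t₀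

/-- Condition (A2) for `ν, c₂`: `ℙ_ν(t < τ_∂) ≥ c₂ ℙ_x(t < τ_∂)` for all `t ≥ 0`, `x ∈ E`. -/
def CondA2 (ν : Measure E) (c₂ : ℝ) : Prop :=
  ∀ t x, c₂ * 𝕏.survival (𝕏.pr x) t ≤ 𝕏.survival (𝕏.prInit ν) t

/-- The relations that say what the quasi-stationary distribution `α`, the absorption rate `lam`
(`λ₀`), the function `η` and the constants `γ, C, C', C''` are. -/
structure IsSpectralData (α : Measure E) (η : E → ℝ) (lam γ C C' C'' : ℝ) : Prop where
  quasiStationary : 𝕏.IsQuasiStationary α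
  lam_pos : 0 < lam
  survival_eq : ∀ t : ℝ≥0, 𝕏.survival (𝕏.prInit α) t = Real.exp (-lam * t)
  C_pos : 0 < C
  γ_pos : 0 < γ
  tv_le : ∀ μ : Measure E, IsProbabilityMeasure μ → ∀ t : ℝ≥0,
    tvDist (toForm (𝕏.condLaw (𝕏.prInit μ) t)) (toForm α) ≤ ENNReal.ofReal (C * Real.exp (-γ * t))
  η_bddMeas : IsBddMeas η
  η_nonneg : ∀ x, 0 ≤ η x
  η_integral : ∫ x, η x ∂α = 1
  η_approx : ∀ (x : E) (t : ℝ≥0),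
    |Real.exp (lam * t) * 𝕏.survival (𝕏.pr x) t - η x| ≤ C' * Real.exp (-γ * t)
  survival_le : ∀ (x : E) (t : ℝ≥0), 𝕏.survival (𝕏.pr x) t ≤ C'' * Real.exp (-lam * t)

end AbsorbedMarkovProcess

end

/-! Up to null sets, survival at time `t` means `X_t ∈ E`, so the whole statement concerns the
sub-Markov semigroup `P_t` on `E` (`toSemigroup`).

Existence of the data. By (A1) and (A2), the range of `P_t f / P_t 1` shrinks by the factor `1 - c₁
c₂` whenever `t` grows by `t₀` (`Doeblin.contract`). So the laws conditioned on survival forget the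
initial law exponentially fast and uniformly; started from `ν` they are Cauchy, and their limit `α`
is quasi-stationary. Then `α P_t = φ(t) α` with `φ` multiplicative, hence `φ(t) = exp (-λ₀ t)`, and
almost sure absorption gives `λ₀ > 0`. Integrating (A1) against `α` bounds `P_t 1` by a multiple of
`φ(t)`, and the forgetting estimate makes `exp (λ₀ t) P_t 1` uniformly Cauchy, with limit `η`.

Estimates for arbitrary data. Writing `P_t f` as survival probability times conditional expectation
gives `|P_t f - exp (-λ₀ t) α(f) η| ≤ (C C'' + C') ‖f‖ exp (-(λ₀ + γ) t)`. Applying `A` amounts to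
integrating over all times after `t`, which divides the main term by `λ₀` and the error by `λ₀ + γ`
and leaves both exponentials in place (`abs_op_iterate_sub_le`). The value at `t = 0` is the bound
on `A^n`. Summation against `t^n / n!` yields main term `exp (t / λ₀)` and error `exp (t / (λ₀ +
γ))`. The normalized statements follow from an elementary estimate of quotients (`abs_div_sub_le`),
once `η > 0` is known (`η_pos`). -/

noncomputable section

open Filter Topology

/-! ### Bounded measurable functions -/

namespace IsBddMeas

variable {E : Type*} [MeasurableSpace E] {f g : E → ℝ}

lemma integrable (hf : IsBddMeas f) (μ : Measure E) [IsFiniteMeasure μ] : Integrable f μ := by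
  obtain ⟨hm, M, hM⟩ := hf
  exact Integrable.of_bound hm.aestronglyMeasurable M (Eventually.of_forall hM)

lemma const (c : ℝ) : IsBddMeas (fun _ : E => c) := ⟨measurable_const, |c|, fun _ => le_rfl⟩

lemma one : IsBddMeas (1 : E → ℝ) := const 1

lemma sub (hf : IsBddMeas f) (hg : IsBddMeas g) : IsBddMeas (fun x => f x - g x) := by
  obtain ⟨hm, M, hM⟩ := hf
  obtain ⟨hm', M', hM'⟩ := hg
  exact ⟨hm.sub hm', M + M', fun x => (abs_sub _ _).trans (add_le_add (hM x) (hM' x))⟩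

lemma const_mul (c : ℝ) (hf : IsBddMeas f) : IsBddMeas (fun x => c * f x) := by
  obtain ⟨hm, M, hM⟩ := hf
  exact ⟨hm.const_mul c, |c| * M, fun x => by
    rw [abs_mul]; exact mul_le_mul_of_nonneg_left (hM x) (abs_nonneg _)⟩

lemma indicator_one {B : Set E} (hB : MeasurableSet B) :
    IsBddMeas (B.indicator (fun _ => (1 : ℝ))) :=
  ⟨measurable_const.indicator hB, 1, fun x => by
    by_cases h : x ∈ B <;> simp [h]⟩

lemma abs_le_supNorm (hf : IsBddMeas f) (x : E) : |f x| ≤ supNorm f := by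
  obtain ⟨-, M, hM⟩ := hf
  exact le_ciSup (f := fun x => |f x|) ⟨M, by rintro _ ⟨y, rfl⟩; exact hM y⟩ x

end IsBddMeas

lemma supNorm_nonneg {E : Type*} (f : E → ℝ) : 0 ≤ supNorm f :=
  Real.iSup_nonneg fun _ => abs_nonneg _

lemma supNorm_le {E : Type*} {f : E → ℝ} {M : ℝ} (hM : 0 ≤ M) (h : ∀ x, |f x| ≤ M) :
    supNorm f ≤ M := Real.iSup_le h hM

/-! ### Sub-Markov semigroups -/

/-- A jointly measurable semigroup of sub-Markov kernels. -/
structure SubMarkovSemigroup (E : Type*) [MeasurableSpace E] where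
  /-- `(t, x) ↦ P_t(x, ·)` -/
  P : Kernel (ℝ≥0 × E) E
  mass_le : ∀ p, P p Set.univ ≤ 1
  zero : ∀ x, P (0, x) = Measure.dirac x
  add : ∀ s t x, P (s + t, x) = (P (s, x)).bind (fun y => P (t, y))

namespace SubMarkovSemigroup

variable {E : Type*} [MeasurableSpace E] (S : SubMarkovSemigroup E)

instance : IsFiniteKernel S.P := ⟨⟨1, ENNReal.one_lt_top, S.mass_le⟩⟩

/-- The kernel `P_t`. -/
def kernel (t : ℝ≥0) : Kernel E E := S.P.comap (Prod.mk t) measurable_prodMk_left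

instance (t : ℝ≥0) : IsFiniteKernel (S.kernel t) := by unfold kernel; infer_instance

@[simp] lemma kernel_apply (t : ℝ≥0) (x : E) : S.kernel t x = S.P (t, x) := rfl

/-- The operator `f ↦ P_t f`. -/
def op (t : ℝ≥0) (f : E → ℝ) (x : E) : ℝ := ∫ y, f y ∂(S.P (t, x))

/-- The survival probability `P_t 1`. -/
def surv (t : ℝ≥0) (x : E) : ℝ := S.op t 1 x

lemma surv_eq (t : ℝ≥0) (x : E) : S.surv t x = (S.P (t, x)).real Set.univ := by
  simp [surv, op]

lemma surv_nonneg (t : ℝ≥0) (x : E) : 0 ≤ S.surv t x := by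
  rw [surv_eq]; exact measureReal_nonneg

lemma surv_le_one (t : ℝ≥0) (x : E) : S.surv t x ≤ 1 := by
  rw [surv_eq]; exact ENNReal.toReal_le_of_le_ofReal zero_le_one (by simpa using S.mass_le _)

lemma measurable_op_uncurry {f : E → ℝ} (hf : Measurable f) :
    Measurable fun p : ℝ≥0 × E => S.op p.1 f p.2 :=
  (hf.stronglyMeasurable.integral_kernel (κ := S.P)).measurable

lemma measurable_op {f : E → ℝ} (hf : Measurable f) (t : ℝ≥0) : Measurable (S.op t f) :=
  (S.measurable_op_uncurry hf).comp measurable_prodMk_left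

lemma op_mono {f g : E → ℝ} (hf : IsBddMeas f) (hg : IsBddMeas g) (h : ∀ x, f x ≤ g x)
    (t : ℝ≥0) (x : E) : S.op t f x ≤ S.op t g x :=
  integral_mono (hf.integrable _) (hg.integrable _) h

lemma op_const (c : ℝ) (t : ℝ≥0) (x : E) : S.op t (fun _ => c) x = c * S.surv t x := by
  simp [op, surv_eq, mul_comm]

lemma op_const_mul (c : ℝ) (f : E → ℝ) (t : ℝ≥0) (x : E) :
    S.op t (fun y => c * f y) x = c * S.op t f x := integral_const_mul _ _

lemma op_sub {f g : E → ℝ} (hf : IsBddMeas f) (hg : IsBddMeas g) (t : ℝ≥0) (x : E) :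
    S.op t (fun y => f y - g y) x = S.op t f x - S.op t g x :=
  integral_sub (hf.integrable _) (hg.integrable _)

lemma abs_op_le {f : E → ℝ} {M : ℝ} (hM : ∀ x, |f x| ≤ M) (t : ℝ≥0)
    (x : E) : |S.op t f x| ≤ M * S.surv t x := by
  have := norm_integral_le_of_norm_le_const (μ := S.P (t, x)) (f := f) (Eventually.of_forall hM)
  rwa [← surv_eq] at this

lemma isBddMeas_op {f : E → ℝ} (hf : IsBddMeas f) (t : ℝ≥0) : IsBddMeas (S.op t f) := by
  obtain ⟨M, hM⟩ := hf.2
  refine ⟨S.measurable_op hf.1 t, M, fun x => (S.abs_op_le hM t x).trans ?_⟩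
  exact mul_le_of_le_one_right ((abs_nonneg _).trans (hM x)) (S.surv_le_one t x)

lemma isBddMeas_surv (t : ℝ≥0) : IsBddMeas (S.surv t) := S.isBddMeas_op .one t

lemma op_zero {f : E → ℝ} (hf : Measurable f) (x : E) : S.op 0 f x = f x := by
  rw [op, S.zero, integral_dirac' _ _ hf.stronglyMeasurable]

/-- The measure `μ P_t`. -/
def push (μ : Measure E) (t : ℝ≥0) : Measure E := μ.bind (S.kernel t)

instance (μ : Measure E) [IsFiniteMeasure μ] (t : ℝ≥0) : IsFiniteMeasure (S.push μ t) := by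
  unfold push; infer_instance

lemma integral_push (μ : Measure E) [IsFiniteMeasure μ] (t : ℝ≥0) {f : E → ℝ}
    (hf : IsBddMeas f) : ∫ x, f x ∂(S.push μ t) = ∫ x, S.op t f x ∂μ := by
  have h := Kernel.integral_comp (κ := Kernel.const Unit μ) (η := S.kernel t) (a := ()) (f := f)
    (by
      have : IsFiniteMeasure ((S.kernel t ∘ₖ Kernel.const Unit μ) ()) := inferInstance
      exact hf.integrable _)
  rw [← Measure.comp_eq_comp_const_apply] at h
  simp only [Kernel.const_apply, kernel_apply] at h
  exact h

lemma op_add {f : E → ℝ} (hf : IsBddMeas f) (s t : ℝ≥0) (x : E) :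
    S.op (s + t) f x = S.op s (S.op t f) x := by
  have := S.integral_push (S.P (s, x)) t hf
  rw [op, S.add]
  exact this

lemma surv_add (s t : ℝ≥0) (x : E) : S.surv (s + t) x = S.op s (S.surv t) x :=
  S.op_add .one s t x

lemma surv_antitone (x : E) : Antitone fun t => S.surv t x := by
  intro s t hst
  obtain ⟨u, rfl⟩ := exists_add_of_le hst
  simp only [surv_add]
  exact S.op_mono (S.isBddMeas_surv u) .one (S.surv_le_one u) s x

end SubMarkovSemigroup

/-! ### Limits of probability measures and multiplicative functions -/

lemma integral_pos_of_forall_pos {E : Type*} [MeasurableSpace E] {f : E → ℝ} (hf : IsBddMeas f)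
    (hpos : ∀ x, 0 < f x) (μ : Measure E) [IsProbabilityMeasure μ] : 0 < ∫ x, f x ∂μ := by
  rw [integral_pos_iff_support_of_nonneg (fun x => (hpos x).le) (hf.integrable μ)]
  have : Function.support f = Set.univ := Set.eq_univ_of_forall fun x => (hpos x).ne'
  simp [this]

/-- A sequence of probability measures that is Cauchy uniformly on measurable sets converges
against bounded measurable functions. -/
lemma exists_limit_of_uniform_cauchy {E : Type*} [MeasurableSpace E] (Q : ℕ → Measure E)
    [∀ n, IsProbabilityMeasure (Q n)] {r : ℕ → ℝ} (hr : Tendsto r atTop (𝓝 0))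
    (h : ∀ n m, n ≤ m → ∀ B, MeasurableSet B → |(Q m).real B - (Q n).real B| ≤ r n) :
    ∃ α : Measure E, IsProbabilityMeasure α ∧ ∀ f, IsBddMeas f →
      Tendsto (fun n => ∫ x, f x ∂(Q n)) atTop (𝓝 (∫ x, f x ∂α)) := by
  have hlim : ∀ B, MeasurableSet B → ∃ l, Tendsto (fun n => (Q n).real B) atTop (𝓝 l) := by
    intro B hB
    refine cauchySeq_tendsto_of_complete (cauchySeq_of_le_tendsto_0' r (fun n m hnm => ?_) hr)
    rw [dist_comm, Real.dist_eq]
    exact h n m hnm B hB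
  choose! l hl using hlim
  have hl0 : ∀ B, MeasurableSet B → 0 ≤ l B := fun B hB =>
    ge_of_tendsto' (hl B hB) fun n => measureReal_nonneg
  have hlr : ∀ n B, MeasurableSet B → |l B - (Q n).real B| ≤ r n := fun n B hB =>
    le_of_tendsto ((hl B hB).sub_const _).abs
      (eventually_atTop.2 ⟨n, fun m hm => h n m hm B hB⟩)
  have hsum : ∀ B : ℕ → Set E, (∀ i, MeasurableSet (B i)) → Pairwise (Function.onFun Disjoint B) →
      HasSum (fun i => l (B i)) (l (⋃ i, B i)) := by
    intro B hB hd
    have hfin : ∀ (s : Finset ℕ) n, ∑ i ∈ s, (Q n).real (B i) = (Q n).real (⋃ i ∈ s, B i) :=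
      fun s n => (measureReal_biUnion_finset (fun i _ j _ hij => hd hij) fun i _ => hB i).symm
    have hfl : ∀ s : Finset ℕ, ∑ i ∈ s, l (B i) = l (⋃ i ∈ s, B i) := fun s => by
      refine tendsto_nhds_unique (tendsto_finsetSum s fun i _ => hl (B i) (hB i)) ?_
      simp only [hfin]
      exact hl _ (s.measurableSet_biUnion fun i _ => hB i)
    -- The partial sums converge uniformly over all finite index sets, because each is the mass of a
    -- single measurable set. This permits exchanging the limit in `n` with the infinite sum, so `l`
    -- is countably additive.
    have hu : TendstoUniformly (fun n (s : Finset ℕ) => ∑ i ∈ s, (Q n).real (B i))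
        (fun s => ∑ i ∈ s, l (B i)) atTop := by
      rw [Metric.tendstoUniformly_iff]
      intro ε hε
      filter_upwards [hr.eventually (gt_mem_nhds hε)] with n hn s
      rw [hfl, hfin, Real.dist_eq]
      exact (hlr n _ (s.measurableSet_biUnion fun i _ => hB i)).trans_lt hn
    refine hu.tendsto_of_eventually_tendsto (p' := atTop)
      (Eventually.of_forall fun n => ?_) (hl _ (.iUnion hB))
    have := ENNReal.hasSum_toReal (f := fun i => Q n (B i))
      (by rw [← measure_iUnion hd hB]; exact measure_ne_top _ _)
    rwa [← ENNReal.tsum_toReal_eq (fun i => measure_ne_top _ _), ← measure_iUnion hd hB] at this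
  let α : Measure E := Measure.ofMeasurable (fun B _ => ENNReal.ofReal (l B))
    (by
      rw [tendsto_nhds_unique (hl ∅ .empty) (by simp : Tendsto _ _ (𝓝 (0 : ℝ)))]
      simp)
    (fun B hB hd => by
      have := hsum B hB hd
      rw [← this.tsum_eq, ENNReal.ofReal_tsum_of_nonneg (fun i => hl0 _ (hB i)) this.summable])
  have hα : ∀ B, MeasurableSet B → α B = ENNReal.ofReal (l B) := fun B hB =>
    Measure.ofMeasurable_apply B hB
  have hprob : IsProbabilityMeasure α := ⟨by
    rw [hα _ .univ, tendsto_nhds_unique (hl .univ .univ) (by simp : Tendsto _ _ (𝓝 (1 : ℝ)))]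
    simp⟩
  have hαr : ∀ B, MeasurableSet B → α.real B = l B := fun B hB => by
    rw [measureReal_def, hα B hB, ENNReal.toReal_ofReal (hl0 B hB)]
  have hnonneg : ∀ f, IsBddMeas f → (∀ x, 0 ≤ f x) →
      Tendsto (fun n => ∫ x, f x ∂(Q n)) atTop (𝓝 (∫ x, f x ∂α)) := by
    intro f hf hf0
    obtain ⟨M, hM⟩ := hf.2
    -- Layer-cake formula: convergence on the level sets gives convergence of integrals by dominated
    -- convergence on `(0, M]`.
    have key : ∀ (μ : Measure E) [IsProbabilityMeasure μ],
        ∫ x, f x ∂μ = ∫ t in Set.Ioc 0 M, μ.real {a | t ≤ f a} := fun μ _ =>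
      (hf.integrable μ).integral_eq_integral_Ioc_meas_le (Eventually.of_forall hf0)
        (Eventually.of_forall fun x => (le_abs_self _).trans (hM x))
    simp only [key]
    refine tendsto_integral_of_dominated_convergence (fun _ => 1) (fun n => ?_) (by simp)
      (fun n => Eventually.of_forall fun t => ?_) (Eventually.of_forall fun t => ?_)
    · refine (Antitone.measurable fun s t hst => ?_).aestronglyMeasurable
      exact measureReal_mono fun a (ha : t ≤ f a) => hst.trans ha
    · rw [Real.norm_eq_abs, abs_of_nonneg measureReal_nonneg]
      exact measureReal_le_one
    · have hB : MeasurableSet {a | t ≤ f a} := measurableSet_le measurable_const hf.1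
      rw [hαr _ hB]
      exact hl _ hB
  refine ⟨α, hprob, fun f hf => ?_⟩
  obtain ⟨M, hM⟩ := hf.2
  have hg : IsBddMeas fun x => f x - (-M) := hf.sub (.const _)
  have := hnonneg _ hg fun x => by linarith [neg_abs_le (f x), hM x]
  have e : ∀ (μ : Measure E) [IsProbabilityMeasure μ],
      ∫ x, f x - (-M) ∂μ = ∫ x, f x ∂μ + M := fun μ _ => by
    rw [integral_sub (hf.integrable μ) (integrable_const _)]; simp
  simp only [e] at this
  simpa using this.sub_const M

/-- A positive multiplicative antitone function on `[0, ∞)` is an exponential. -/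
lemma eq_exp_of_antitone_of_mul {φ : ℝ≥0 → ℝ} (hpos : ∀ t, 0 < φ t) (hanti : Antitone φ)
    (hmul : ∀ s t, φ (s + t) = φ s * φ t) (t : ℝ≥0) : φ t = Real.exp (Real.log (φ 1) * t) := by
  have hpow : ∀ (n : ℕ) (s : ℝ≥0), φ (n * s) = φ s ^ n := by
    intro n s
    induction n with
    | zero =>
      have := hmul 0 0
      have h0 := hpos 0
      rw [add_zero] at this
      simp only [Nat.cast_zero, zero_mul, pow_zero]
      nlinarith
    | succ n ih => rw [Nat.cast_succ, add_mul, one_mul, hmul, ih, pow_succ]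
  set L : ℝ≥0 → ℝ := fun s => -Real.log (φ s) with hL
  have hLn : ∀ (n : ℕ) s, L (n * s) = n * L s := fun n s => by simp [hL, hpow]
  have hmono : Monotone L := fun s u hsu =>
    neg_le_neg (Real.log_le_log (hpos u) (hanti hsu))
  -- With `k = ⌊n t⌋`, monotonicity puts both `n L(t)` and `n t L(1)` between `k L(1)` and `(k + 1)
  -- L(1)`.
  have hclose : ∀ n : ℕ, 0 < n → |L t - t * L 1| ≤ L 1 / n := by
    intro n hn
    have hn' : (0 : ℝ) < n := Nat.cast_pos.2 hn
    set k := ⌊(n : ℝ≥0) * t⌋₊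
    have h1 : (k : ℝ≥0) ≤ n * t := Nat.floor_le zero_le
    have h2 : (n : ℝ≥0) * t ≤ (k + 1 : ℕ) := by
      push_cast; exact (Nat.lt_floor_add_one _).le
    have l1 := hmono h1
    have l2 := hmono h2
    have e1 := hLn k 1
    have e2 := hLn (k + 1) 1
    rw [mul_one] at e1 e2
    rw [hLn, e1] at l1
    rw [hLn, e2] at l2
    have h1' : (k : ℝ) ≤ n * t := by exact_mod_cast h1
    have h2' : (n : ℝ) * t ≤ k + 1 := by exact_mod_cast h2
    push_cast at l2
    have hL1 : 0 ≤ L 1 := by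
      have := hmono (show (0 : ℝ≥0) ≤ 1 from zero_le)
      have h00 := hLn 0 0
      simp only [Nat.cast_zero, zero_mul] at h00
      linarith
    rw [abs_le, neg_le, le_div_iff₀ hn', le_div_iff₀ hn']
    constructor <;> nlinarith
  have hle : |L t - t * L 1| ≤ 0 := by
    refine ge_of_tendsto (tendsto_const_div_atTop_nhds_zero_nat (L 1)) ?_
    filter_upwards [eventually_gt_atTop 0] with n hn using hclose n hn
  have h0 := abs_nonpos_iff.1 hle
  rw [← Real.exp_log (hpos t)]
  congr 1
  simp only [hL] at h0
  linarith

/-! ### Laws conditioned on survival and their contraction -/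

namespace SubMarkovSemigroup

variable {E : Type*} [MeasurableSpace E] (S : SubMarkovSemigroup E)

/-- The law at time `t` conditioned on survival, for the initial law `μ`. -/
def cond (μ : Measure E) (t : ℝ≥0) : Measure E := (S.push μ t Set.univ)⁻¹ • S.push μ t

lemma push_real_univ (μ : Measure E) [IsFiniteMeasure μ] (t : ℝ≥0) :
    (S.push μ t).real Set.univ = ∫ x, S.surv t x ∂μ := by
  have := S.integral_push μ t .one
  simpa [surv] using this

lemma integral_cond (μ : Measure E) [IsFiniteMeasure μ] (t : ℝ≥0) {f : E → ℝ}
    (hf : IsBddMeas f) :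
    ∫ x, f x ∂(S.cond μ t) = (∫ x, S.op t f x ∂μ) / ∫ x, S.surv t x ∂μ := by
  rw [cond, integral_smul_measure, S.integral_push μ t hf, ENNReal.toReal_inv, ← measureReal_def,
    push_real_univ, smul_eq_mul, div_eq_inv_mul]

/-- Survival has positive probability, together with the conditions (A1) and (A2). -/
structure Doeblin (ν : Measure E) (t₀ : ℝ≥0) (c₁ c₂ : ℝ) : Prop where
  surv_pos : ∀ t x, 0 < S.surv t x
  prob : IsProbabilityMeasure ν
  t₀_pos : 0 < t₀
  c₁_pos : 0 < c₁
  c₂_pos : 0 < c₂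
  minor : ∀ x f, IsBddMeas f → (∀ y, 0 ≤ f y) → c₁ * S.surv t₀ x * ∫ y, f y ∂ν ≤ S.op t₀ f x
  survive : ∀ t x, c₂ * S.surv t x ≤ ∫ y, S.surv t y ∂ν

variable {S} {ν : Measure E} {t₀ : ℝ≥0} {c₁ c₂ : ℝ}

lemma isProbabilityMeasure_cond (hpos : ∀ t x, 0 < S.surv t x) (μ : Measure E)
    [IsProbabilityMeasure μ] (t : ℝ≥0) : IsProbabilityMeasure (S.cond μ t) := by
  refine ⟨?_⟩
  have h : 0 < (S.push μ t).real Set.univ := by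
    rw [push_real_univ]; exact integral_pos_of_forall_pos (S.isBddMeas_surv t) (hpos t) μ
  have h0 : S.push μ t Set.univ ≠ 0 := fun h0 => by simp [measureReal_def, h0] at h
  rw [cond, Measure.smul_apply, smul_eq_mul, ENNReal.inv_mul_cancel h0 (measure_ne_top _ _)]

/-- Markov property of conditioning on survival: the normalization at time `s` cancels in the
quotient. -/
lemma integral_cond_add (hpos : ∀ t x, 0 < S.surv t x) (μ : Measure E)
    [IsProbabilityMeasure μ] (s t : ℝ≥0) {f : E → ℝ} (hf : IsBddMeas f) :
    ∫ x, f x ∂(S.cond μ (s + t)) = ∫ x, f x ∂(S.cond (S.cond μ s) t) := by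
  have := isProbabilityMeasure_cond hpos μ s
  have h : ∫ x, S.surv s x ∂μ ≠ 0 :=
    (integral_pos_of_forall_pos (S.isBddMeas_surv s) (hpos s) μ).ne'
  rw [S.integral_cond _ _ hf, S.integral_cond _ _ hf, S.integral_cond _ _ (S.isBddMeas_op hf t),
    S.integral_cond _ _ (S.isBddMeas_surv t), div_div_div_cancel_right₀ h]
  simp only [← S.op_add hf, ← S.surv_add]

namespace Doeblin

lemma nonempty (H : S.Doeblin ν t₀ c₁ c₂) : Nonempty E := by
  have := H.prob
  exact ν.nonempty_of_neZero

/-- Makes the contraction factor `1 - c₁ c₂` nonnegative. Total mass in (A1) gives `c₁ ≤ 1`, and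
time `0` in (A2) gives `c₂ ≤ 1`. -/
lemma mul_le_one (H : S.Doeblin ν t₀ c₁ c₂) : c₁ * c₂ ≤ 1 := by
  have := H.prob
  obtain ⟨x⟩ := H.nonempty
  have h1 := H.minor x 1 .one fun _ => zero_le_one
  simp only [Pi.one_apply, integral_const, probReal_univ, smul_eq_mul, mul_one] at h1
  have h2 := H.survive 0 x
  have e : S.surv 0 = 1 := by ext x; simp [surv, S.op_zero measurable_one]
  simp only [e, Pi.one_apply, integral_const, probReal_univ, smul_eq_mul, mul_one] at h2
  have h3 := H.surv_pos t₀ x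
  change _ ≤ S.surv t₀ x at h1
  have : c₁ ≤ 1 := by nlinarith
  nlinarith [H.c₁_pos, H.c₂_pos]

/-- (A2) bounds `P_t 1` by the constant `ν(P_t 1) / c₂` before `P_{t₀}` is applied. This converts
the factor `P_{t₀} 1` of the minorization into `P_{t₀+t} 1`. -/
lemma surv_add_le (H : S.Doeblin ν t₀ c₁ c₂) (t : ℝ≥0) (x : E) :
    c₂ * S.surv (t₀ + t) x ≤ S.surv t₀ x * ∫ y, S.surv t y ∂ν := by
  have h := S.op_mono (S.isBddMeas_surv t) (IsBddMeas.const ((∫ y, S.surv t y ∂ν) / c₂))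
    (fun y => by rw [le_div_iff₀ H.c₂_pos, mul_comm]; exact H.survive t y) t₀ x
  rw [← surv_add, op_const, div_mul_eq_mul_div, le_div_iff₀ H.c₂_pos] at h
  linarith

/-- If `P_t f / P_t 1` takes its values in an interval, then `P_{t₀+t} f / P_{t₀+t} 1` takes
them in an interval that is shorter by the factor `1 - c₁ c₂`. -/
lemma contract (H : S.Doeblin ν t₀ c₁ c₂) {t : ℝ≥0} {a b : ℝ} {f : E → ℝ} (hf : IsBddMeas f)
    (h : ∀ x, a * S.surv t x ≤ S.op t f x ∧ S.op t f x ≤ b * S.surv t x) :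
    ∃ a' b', b' - a' = (1 - c₁ * c₂) * (b - a) ∧ ∀ x,
      a' * S.surv (t₀ + t) x ≤ S.op (t₀ + t) f x ∧ S.op (t₀ + t) f x ≤ b' * S.surv (t₀ + t) x := by
  have := H.prob
  have hs := S.isBddMeas_surv t
  have hp := S.isBddMeas_op hf t
  set N := ∫ y, S.surv t y ∂ν with hN
  set F := ∫ y, S.op t f y ∂ν with hF
  have hN0 : 0 < N := integral_pos_of_forall_pos hs (H.surv_pos t) ν
  have haF : a * N ≤ F := by
    rw [hN, ← integral_const_mul]
    exact integral_mono ((hs.const_mul a).integrable _) (hp.integrable _) fun x => (h x).1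
  have hbF : F ≤ b * N := by
    rw [hN, ← integral_const_mul]
    exact integral_mono (hp.integrable _) ((hs.const_mul b).integrable _) fun x => (h x).2
  have hm : F / N * N = F := div_mul_cancel₀ _ hN0.ne'
  have ham : a ≤ F / N := by rwa [le_div_iff₀ hN0]
  have hmb : F / N ≤ b := by rwa [div_le_iff₀ hN0]
  -- Both endpoints move the fraction `c₁ c₂` of the way towards `F / N`, the mean of `f` under the
  -- law started from `ν` and conditioned on survival to `t`.
  refine ⟨a + c₁ * c₂ * (F / N - a), b - c₁ * c₂ * (b - F / N), by ring, fun x => ?_⟩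
  have key := H.surv_add_le t x
  rw [← hN] at key
  -- The minorization is applied to the two nonnegative functions `P_t f - a P_t 1` and `b P_t 1 -
  -- P_t f`.
  have h1 := H.minor x _ (hp.sub (hs.const_mul a)) fun y => sub_nonneg.2 (h y).1
  have h2 := H.minor x _ ((hs.const_mul b).sub hp) fun y => sub_nonneg.2 (h y).2
  rw [integral_sub (hp.integrable _) ((hs.const_mul a).integrable _), integral_const_mul,
    S.op_sub hp (hs.const_mul a), op_const_mul, ← surv_add, ← S.op_add hf, ← hN, ← hF] at h1
  rw [integral_sub ((hs.const_mul b).integrable _) (hp.integrable _), integral_const_mul,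
    S.op_sub (hs.const_mul b) hp, op_const_mul, ← surv_add, ← S.op_add hf, ← hN, ← hF] at h2
  have k1 := mul_le_mul_of_nonneg_left key (mul_nonneg H.c₁_pos.le (sub_nonneg.2 ham))
  have k2 := mul_le_mul_of_nonneg_left key (mul_nonneg H.c₁_pos.le (sub_nonneg.2 hmb))
  have e1 : c₁ * (F / N - a) * (S.surv t₀ x * N) = c₁ * S.surv t₀ x * (F - a * N) := by
    rw [← hm]; ring_nf; field_simp
  have e2 : c₁ * (b - F / N) * (S.surv t₀ x * N) = c₁ * S.surv t₀ x * (b * N - F) := by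
    rw [← hm]; ring_nf; field_simp
  constructor <;> nlinarith

/-- Iteration of `contract` from the interval `[-1, 1]`, whose length is the factor `2`. The extra
time `u` accommodates times that are not multiples of `t₀`. -/
lemma exists_interval (H : S.Doeblin ν t₀ c₁ c₂)
    {f : E → ℝ} (hf : Measurable f) (hf1 : ∀ x, |f x| ≤ 1) (n : ℕ) (u : ℝ≥0) :
    ∃ a b, b - a = 2 * (1 - c₁ * c₂) ^ n ∧ ∀ x,
      a * S.surv (n * t₀ + u) x ≤ S.op (n * t₀ + u) f x ∧
      S.op (n * t₀ + u) f x ≤ b * S.surv (n * t₀ + u) x := by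
  induction n with
  | zero =>
    refine ⟨-1, 1, by norm_num, fun x => ?_⟩
    have := abs_le.1 (S.abs_op_le hf1 ((0 : ℕ) * t₀ + u) x)
    constructor <;> linarith [this.1, this.2]
  | succ n ih =>
    obtain ⟨a, b, hab, h⟩ := ih
    obtain ⟨a', b', hab', h'⟩ := H.contract ⟨hf, 1, hf1⟩ h
    refine ⟨a', b', by rw [hab', hab, pow_succ]; ring, ?_⟩
    have e : ((n + 1 : ℕ) : ℝ≥0) * t₀ + u = t₀ + (n * t₀ + u) := by push_cast; ring
    rw [e]
    exact h'

/-- The conditional expectation is the mean of `P_t f / P_t 1` with weights `P_t 1`, so it stays in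
every interval containing all these ratios. -/
lemma integral_cond_mem (H : S.Doeblin ν t₀ c₁ c₂)
    {μ : Measure E} [IsProbabilityMeasure μ] {f : E → ℝ} (hf : IsBddMeas f)
    {t : ℝ≥0} {a b : ℝ}
    (h : ∀ x, a * S.surv t x ≤ S.op t f x ∧ S.op t f x ≤ b * S.surv t x) :
    a ≤ ∫ x, f x ∂(S.cond μ t) ∧ ∫ x, f x ∂(S.cond μ t) ≤ b := by
  have hs := S.isBddMeas_surv t
  have hp := S.isBddMeas_op hf t
  have h0 : 0 < ∫ x, S.surv t x ∂μ := integral_pos_of_forall_pos hs (H.surv_pos t) μ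
  rw [S.integral_cond μ t hf, le_div_iff₀ h0, div_le_iff₀ h0, ← integral_const_mul,
    ← integral_const_mul]
  exact ⟨integral_mono ((hs.const_mul a).integrable _) (hp.integrable _) fun x => (h x).1,
    integral_mono (hp.integrable _) ((hs.const_mul b).integrable _) fun x => (h x).2⟩

/-- The conditional laws forget the initial law exponentially fast. -/
lemma exists_forget (H : S.Doeblin ν t₀ c₁ c₂) : ∃ C γ : ℝ, 0 < C ∧ 0 < γ ∧ ∀ μ₁ μ₂ : Measure E,
    IsProbabilityMeasure μ₁ → IsProbabilityMeasure μ₂ → ∀ f : E → ℝ, Measurable f →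
    (∀ x, |f x| ≤ 1) → ∀ t : ℝ≥0,
    |∫ x, f x ∂(S.cond μ₁ t) - ∫ x, f x ∂(S.cond μ₂ t)| ≤ C * Real.exp (-γ * t) := by
  set c := c₁ * c₂ with hc
  have hc0 : 0 < c := mul_pos H.c₁_pos H.c₂_pos
  have ht₀ : (0 : ℝ) < t₀ := H.t₀_pos
  -- For `n = ⌊t / t₀⌋ ≥ t / t₀ - 1`, `(1 - c)^n ≤ exp (-c n) ≤ exp c * exp (-c t / t₀)`.
  refine ⟨2 * Real.exp c, c / t₀, by positivity, by positivity, ?_⟩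
  intro μ₁ μ₂ _ _ f hf hf1 t
  set n := ⌊t / t₀⌋₊ with hn
  have hn1 : (n : ℝ≥0) * t₀ ≤ t := by
    rw [← le_div_iff₀ H.t₀_pos]; exact Nat.floor_le zero_le
  have hn2 : (t : ℝ) / t₀ ≤ n + 1 := by
    have : t / t₀ ≤ n + 1 := (Nat.lt_floor_add_one _).le
    exact_mod_cast this
  obtain ⟨u, hu⟩ := exists_add_of_le hn1
  obtain ⟨a, b, hab, h⟩ := H.exists_interval hf hf1 n u
  rw [← hu] at h
  have m1 := H.integral_cond_mem (μ := μ₁) ⟨hf, 1, hf1⟩ h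
  have m2 := H.integral_cond_mem (μ := μ₂) ⟨hf, 1, hf1⟩ h
  have hb : b - a ≤ 2 * Real.exp c * Real.exp (-(c / t₀) * t) := by
    have h1 : (1 - c) ^ n ≤ Real.exp (-c) ^ n :=
      pow_le_pow_left₀ (sub_nonneg.2 H.mul_le_one) (by linarith [Real.add_one_le_exp (-c)]) n
    have h2 : Real.exp (-c) ^ n ≤ Real.exp c * Real.exp (-(c / t₀) * t) := by
      rw [← Real.exp_nat_mul, ← Real.exp_add, Real.exp_le_exp]
      have : c / t₀ * t = c * (t / t₀) := by ring
      nlinarith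
    rw [hab, mul_assoc]
    linarith
  rw [abs_le]
  constructor <;> linarith [m1.1, m1.2, m2.1, m2.2]

end Doeblin

end SubMarkovSemigroup

/-! ### Existence of the quasi-stationary law, the decay rate and the limit function -/

lemma abs_integral_sub_le_of_unit_ball {E : Type*} [MeasurableSpace E] {μ α : Measure E} {r : ℝ}
    (h : ∀ f : E → ℝ, Measurable f → (∀ x, |f x| ≤ 1) → |∫ x, f x ∂μ - ∫ x, f x ∂α| ≤ r)
    {f : E → ℝ} (hf : Measurable f) {M : ℝ} (hM0 : 0 ≤ M) (hM : ∀ x, |f x| ≤ M) :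
    |∫ x, f x ∂μ - ∫ x, f x ∂α| ≤ M * r := by
  rcases hM0.eq_or_lt with rfl | hM0
  · have : f = 0 := funext fun x => abs_nonpos_iff.1 (hM x)
    simp [this]
  · have := h (fun x => M⁻¹ * f x) (hf.const_mul _) fun x => by
      rw [abs_mul, abs_of_pos (inv_pos.2 hM0), inv_mul_le_iff₀ hM0, mul_one]
      exact hM x
    rwa [integral_const_mul, integral_const_mul, ← mul_sub, abs_mul,
      abs_of_pos (inv_pos.2 hM0), inv_mul_le_iff₀ hM0] at this

lemma tendsto_exp_neg_mul_nat {γ : ℝ} (hγ : 0 < γ) (C : ℝ) :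
    Tendsto (fun n : ℕ => C * Real.exp (-γ * n)) atTop (𝓝 0) := by
  have h : Tendsto (fun n : ℕ => -γ * (n : ℝ)) atTop atBot :=
    tendsto_natCast_atTop_atTop.const_mul_atTop_of_neg (neg_neg_of_pos hγ)
  simpa using (Real.tendsto_exp_atBot.comp h).const_mul C

namespace SubMarkovSemigroup

variable {E : Type*} [MeasurableSpace E] (S : SubMarkovSemigroup E)

/-- Spectral data of the semigroup: a quasi-stationary law `α` with decay rate `lam`, and the
limit `η` of the rescaled survival probabilities, with exponential rates of convergence. -/
structure SpectralData (α : Measure E) (η : E → ℝ) (lam γ C C' C'' : ℝ) : Prop where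
  prob : IsProbabilityMeasure α
  cond_eq : ∀ t, S.cond α t = α
  lam_pos : 0 < lam
  integral_surv : ∀ t : ℝ≥0, ∫ x, S.surv t x ∂α = Real.exp (-lam * t)
  C_pos : 0 < C
  γ_pos : 0 < γ
  tv_le : ∀ μ : Measure E, IsProbabilityMeasure μ → ∀ f : E → ℝ, Measurable f →
    (∀ x, |f x| ≤ 1) → ∀ t : ℝ≥0,
      |∫ x, f x ∂(S.cond μ t) - ∫ x, f x ∂α| ≤ C * Real.exp (-γ * t)
  η_bddMeas : IsBddMeas η
  η_nonneg : ∀ x, 0 ≤ η x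
  η_integral : ∫ x, η x ∂α = 1
  η_approx : ∀ (x : E) (t : ℝ≥0),
    |Real.exp (lam * t) * S.surv t x - η x| ≤ C' * Real.exp (-γ * t)
  surv_le : ∀ (x : E) (t : ℝ≥0), S.surv t x ≤ C'' * Real.exp (-lam * t)

variable {S} {ν : Measure E} {t₀ : ℝ≥0} {c₁ c₂ : ℝ}

/-- This factorization turns total variation bounds for conditional laws into bounds for `P_t f`. -/
lemma op_eq_surv_mul_integral_cond (hpos : ∀ t x, 0 < S.surv t x) {f : E → ℝ} (hf : IsBddMeas f)
    (t : ℝ≥0) (x : E) :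
    S.op t f x = S.surv t x * ∫ y, f y ∂(S.cond (Measure.dirac x) t) := by
  rw [S.integral_cond _ _ hf, integral_dirac' _ _ (S.measurable_op hf.1 t).stronglyMeasurable,
    integral_dirac' _ _ (S.isBddMeas_surv t).1.stronglyMeasurable,
    mul_div_cancel₀ _ (hpos t x).ne']

/-- Quasi-stationarity as an eigenvector equation: `α P_t` is the multiple of `α` by its own mass.
-/
lemma integral_op_of_cond_eq (hpos : ∀ t x, 0 < S.surv t x) {α : Measure E}
    [IsProbabilityMeasure α] (hα : ∀ t, S.cond α t = α) {f : E → ℝ} (hf : IsBddMeas f)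
    (t : ℝ≥0) : ∫ x, S.op t f x ∂α = (∫ x, S.surv t x ∂α) * ∫ x, f x ∂α := by
  have h := S.integral_cond α t hf
  have h0 := integral_pos_of_forall_pos (S.isBddMeas_surv t) (hpos t) α
  rw [hα, eq_div_iff h0.ne'] at h
  rw [← h, mul_comm]

/-- The eigenvector equation makes the mass of `α P_t` multiplicative in `t`. It tends to `0` along
the integers by dominated convergence, which excludes a nonnegative exponent. -/
lemma exists_integral_surv_eq_exp (hpos : ∀ t x, 0 < S.surv t x)
    (hdecay : ∀ x, Tendsto (fun n : ℕ => S.surv n x) atTop (𝓝 0)) {α : Measure E}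
    [IsProbabilityMeasure α] (hα : ∀ t, S.cond α t = α) :
    ∃ lam : ℝ, 0 < lam ∧ ∀ t : ℝ≥0, ∫ x, S.surv t x ∂α = Real.exp (-lam * t) := by
  set φ : ℝ≥0 → ℝ := fun t => ∫ x, S.surv t x ∂α with hφ
  have hexp := eq_exp_of_antitone_of_mul (φ := φ)
    (fun t => integral_pos_of_forall_pos (S.isBddMeas_surv t) (hpos t) α)
    (fun s t hst => integral_mono ((S.isBddMeas_surv t).integrable _)
      ((S.isBddMeas_surv s).integrable _) fun x => S.surv_antitone x hst)
    (fun s t => by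
      simp only [hφ, surv_add]
      exact integral_op_of_cond_eq hpos hα (S.isBddMeas_surv t) s)
  refine ⟨-Real.log (φ 1), ?_, fun t => by rw [neg_neg]; exact hexp t⟩
  by_contra hlam
  have hlog : 0 ≤ Real.log (φ 1) := by linarith
  have hlim : Tendsto (fun n : ℕ => φ n) atTop (𝓝 0) := by
    have := tendsto_integral_of_dominated_convergence (μ := α) (F := fun (n : ℕ) x => S.surv n x)
      (f := fun _ => 0) (fun _ => 1) (fun n => (S.isBddMeas_surv n).1.aestronglyMeasurable)
      (integrable_const _) (fun n => Eventually.of_forall fun x => by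
        rw [Real.norm_eq_abs, abs_of_nonneg (S.surv_nonneg _ _)]; exact S.surv_le_one _ _)
      (Eventually.of_forall hdecay)
    simpa using this
  have : (1 : ℝ) ≤ 0 := ge_of_tendsto' hlim fun n => by
    rw [hexp]; exact Real.one_le_exp (by positivity)
  linarith

namespace Doeblin

/-- The law conditioned to survive to `s + n` is the one conditioned to survive to `n` from another
initial law, so forgetting yields a Cauchy sequence. Invariance of the limit holds because a shift
by `t` does not change it. -/
lemma exists_quasiStationary (H : S.Doeblin ν t₀ c₁ c₂) :
    ∃ (α : Measure E) (C γ : ℝ), IsProbabilityMeasure α ∧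
    0 < C ∧ 0 < γ ∧ (∀ t, S.cond α t = α) ∧
    ∀ μ : Measure E, IsProbabilityMeasure μ → ∀ f : E → ℝ, Measurable f →
    (∀ x, |f x| ≤ 1) → ∀ t : ℝ≥0,
      |∫ x, f x ∂(S.cond μ t) - ∫ x, f x ∂α| ≤ C * Real.exp (-γ * t) := by
  have := H.prob
  obtain ⟨C, γ, hC, hγ, hf⟩ := H.exists_forget
  have hprob : ∀ (μ : Measure E) [IsProbabilityMeasure μ] (t : ℝ≥0),
      IsProbabilityMeasure (S.cond μ t) := isProbabilityMeasure_cond H.surv_pos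
  have hr := tendsto_exp_neg_mul_nat hγ C
  have hind : ∀ (μ : Measure E) {B : Set E}, MeasurableSet B →
      ∫ x, B.indicator (fun _ => (1 : ℝ)) x ∂μ = μ.real B := fun μ B hB => by
    rw [integral_indicator hB]; simp
  have hshift : ∀ (s : ℝ≥0) (n : ℕ) (B : Set E), MeasurableSet B →
      |(S.cond ν (s + n)).real B - (S.cond ν n).real B| ≤ C * Real.exp (-γ * n) := by
    intro s n B hB
    have hp := hprob ν s
    have := hf (S.cond ν s) ν hp inferInstance (B.indicator fun _ => 1)
      (measurable_const.indicator hB) (fun x => by by_cases h : x ∈ B <;> simp [h]) n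
    rwa [← integral_cond_add H.surv_pos _ _ _ (.indicator_one hB), hind _ hB, hind _ hB] at this
  obtain ⟨α, hα, hlim⟩ := exists_limit_of_uniform_cauchy (fun n : ℕ => S.cond ν n) hr
    (fun n m hnm B hB => by
      obtain ⟨k, rfl⟩ := Nat.exists_eq_add_of_le' hnm
      have := hshift k n B hB
      push_cast
      exact this)
  have hqs : ∀ t, S.cond α t = α := by
    intro t
    refine Measure.ext fun B hB => ?_
    have hiB := IsBddMeas.indicator_one hB
    -- Two limits of the same sequence: here the further time `t` is run after time `n`, and the
    -- quotient formula passes to the limit; in `h2` it is run first and forgotten.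
    have h1 : Tendsto (fun n : ℕ => (S.cond ν (t + n)).real B) atTop
        (𝓝 ((S.cond α t).real B)) := by
      have h0 := integral_pos_of_forall_pos (S.isBddMeas_surv t) (H.surv_pos t) α
      have := (hlim _ (S.isBddMeas_op hiB t)).div (hlim _ (S.isBddMeas_surv t)) h0.ne'
      rw [← S.integral_cond α t hiB, hind _ hB] at this
      refine this.congr fun n => ?_
      have hp := hprob ν n
      rw [← hind _ hB, add_comm t, integral_cond_add H.surv_pos _ _ _ hiB, S.integral_cond _ _ hiB]
      rfl
    have h2 : Tendsto (fun n : ℕ => (S.cond ν (t + n)).real B) atTop (𝓝 (α.real B)) := by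
      have hB' := hlim _ hiB
      simp only [hind _ hB] at hB'
      have hd := squeeze_zero_norm
        (f := fun n : ℕ => (S.cond ν (t + n)).real B - (S.cond ν n).real B)
        (fun n => hshift t n B hB) hr
      simpa using hd.add hB'
    have hp := hprob α t
    exact (measureReal_eq_measureReal_iff).1 (tendsto_nhds_unique h1 h2)
  refine ⟨α, C, γ, hα, hC, hγ, hqs, fun μ hμ f hfm hf1 t => ?_⟩
  have := hf μ α hμ hα f hfm hf1 t
  rwa [hqs] at this

/-- (A1), applied to `P_t 1` and integrated against `α`, gives `α(P_t 1) ≥ c₁ ν(P_t 1)` after the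
common factor `α(P_{t₀} 1)` is cancelled; (A2) does the rest. -/
lemma surv_le_integral (H : S.Doeblin ν t₀ c₁ c₂)
    {α : Measure E} [IsProbabilityMeasure α] (hα : ∀ t, S.cond α t = α)
    (t : ℝ≥0) (x : E) : c₁ * c₂ * S.surv t x ≤ ∫ y, S.surv t y ∂α := by
  have hs := S.isBddMeas_surv t
  have h0 := integral_pos_of_forall_pos (S.isBddMeas_surv t₀) (H.surv_pos t₀) α
  have h1 : (∫ y, S.surv t₀ y ∂α) * (c₁ * ∫ y, S.surv t y ∂ν) ≤
      (∫ y, S.surv t₀ y ∂α) * ∫ y, S.surv t y ∂α := by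
    rw [← integral_op_of_cond_eq H.surv_pos hα hs, ← integral_mul_const]
    refine integral_mono (((S.isBddMeas_surv t₀).integrable _).mul_const _)
      ((S.isBddMeas_op hs t₀).integrable _) fun y => ?_
    have := H.minor y _ hs (S.surv_nonneg t)
    dsimp only
    linarith
  have h2 := le_of_mul_le_mul_left h1 h0
  have h3 := mul_le_mul_of_nonneg_left (H.survive t x) H.c₁_pos.le
  linarith

theorem exists_spectralData (H : S.Doeblin ν t₀ c₁ c₂)
    (hdecay : ∀ x, Tendsto (fun n : ℕ => S.surv n x) atTop (𝓝 0)) :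
    ∃ (α : Measure E) (η : E → ℝ) (lam γ C C' C'' : ℝ), S.SpectralData α η lam γ C C' C'' := by
  obtain ⟨α, C, γ, hα, hC, hγ, hqs, htv⟩ := H.exists_quasiStationary
  obtain ⟨lam, hlam, hexp⟩ := exists_integral_surv_eq_exp H.surv_pos hdecay hqs
  have hc : 0 < c₁ * c₂ := mul_pos H.c₁_pos H.c₂_pos
  set K := (c₁ * c₂)⁻¹ with hK
  have hK0 : 0 < K := inv_pos.2 hc
  have hle : ∀ x (t : ℝ≥0), S.surv t x ≤ K * Real.exp (-lam * t) := fun x t => by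
    rw [hK, inv_mul_eq_div, le_div_iff₀ hc, ← hexp, mul_comm]
    exact H.surv_le_integral hqs t x
  set h : ℝ≥0 → E → ℝ := fun t x => Real.exp (lam * t) * S.surv t x with hh
  have hhle : ∀ t x, h t x ≤ K := fun t x => by
    have := mul_le_mul_of_nonneg_left (hle x t) (Real.exp_pos (lam * t)).le
    rwa [mul_left_comm, ← Real.exp_add, neg_mul, add_neg_cancel, Real.exp_zero, mul_one] at this
  have hh0 : ∀ t x, 0 ≤ h t x := fun t x => mul_nonneg (Real.exp_pos _).le (S.surv_nonneg t x)
  have hbm : ∀ t, IsBddMeas (h t) := fun t => (S.isBddMeas_surv t).const_mul _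
  -- The increment is `h t x` times the difference of the integrals of `h u` under the conditional
  -- law and under `α`, the latter integral being `1`. The two factors `K` bound `h t x` and `h u`.
  have hstep : ∀ t u x, |h (t + u) x - h t x| ≤ K * (K * C) * Real.exp (-γ * t) := by
    intro t u x
    have e1 : h (t + u) x = h t x * ∫ y, h u y ∂(S.cond (Measure.dirac x) t) := by
      simp only [hh]
      rw [surv_add, op_eq_surv_mul_integral_cond H.surv_pos (S.isBddMeas_surv u),
        integral_const_mul]
      push_cast
      rw [mul_add, Real.exp_add]
      ring
    have e2 : ∫ y, h u y ∂α = 1 := by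
      simp only [hh]
      rw [integral_const_mul, hexp, ← Real.exp_add]
      simp
    have e3 := abs_integral_sub_le_of_unit_ball
      (fun f hf hf1 => htv (Measure.dirac x) inferInstance f hf hf1 t) (hbm u).1 hK0.le
      (fun y => by rw [abs_of_nonneg (hh0 u y)]; exact hhle u y)
    rw [e2] at e3
    rw [e1, show ∀ a b : ℝ, a * b - a = a * (b - 1) from fun a b => by ring, abs_mul,
      abs_of_nonneg (hh0 t x)]
    exact (mul_le_mul (hhle t x) e3 (abs_nonneg _) hK0.le).trans_eq (by ring)
  have hr := tendsto_exp_neg_mul_nat hγ (K * (K * C))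
  have hlim : ∀ x, ∃ l, Tendsto (fun n : ℕ => h n x) atTop (𝓝 l) := fun x => by
    refine cauchySeq_tendsto_of_complete (cauchySeq_of_le_tendsto_0' _ (fun n m hnm => ?_) hr)
    obtain ⟨k, rfl⟩ := Nat.exists_eq_add_of_le hnm
    rw [dist_comm, Real.dist_eq]
    push_cast
    exact hstep n k x
  choose η hη using hlim
  have happrox : ∀ x (t : ℝ≥0), |h t x - η x| ≤ K * (K * C) * Real.exp (-γ * t) := fun x t => by
    rw [abs_sub_comm]
    refine le_of_tendsto ((hη x).sub_const (h t x)).abs ?_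
    filter_upwards [eventually_ge_atTop ⌈t⌉₊] with n hn
    obtain ⟨u, hu⟩ := exists_add_of_le (Nat.ceil_le.1 hn)
    rw [hu]
    exact hstep t u x
  have hη0 : ∀ x, 0 ≤ η x := fun x => ge_of_tendsto' (hη x) fun n => hh0 n x
  have hηK : ∀ x, η x ≤ K := fun x => le_of_tendsto' (hη x) fun n => hhle n x
  have hηm : Measurable η :=
    measurable_of_tendsto_metrizable (fun n : ℕ => (hbm n).1) (tendsto_pi_nhds.2 hη)
  refine ⟨α, η, lam, γ, C, K * (K * C), K, hα, hqs, hlam, hexp, hC, hγ, htv,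
    ⟨hηm, K, fun x => by rw [abs_of_nonneg (hη0 x)]; exact hηK x⟩, hη0, ?_, happrox, hle⟩
  have h1 : Tendsto (fun n : ℕ => ∫ x, h n x ∂α) atTop (𝓝 (∫ x, η x ∂α)) :=
    tendsto_integral_of_dominated_convergence (fun _ => K)
      (fun n => (hbm n).1.aestronglyMeasurable) (integrable_const _)
      (fun n => Eventually.of_forall fun x => by
        rw [Real.norm_eq_abs, abs_of_nonneg (hh0 n x)]; exact hhle n x)
      (Eventually.of_forall hη)
  refine tendsto_nhds_unique h1 (tendsto_const_nhds.congr fun n => ?_)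
  simp only [hh]
  rw [integral_const_mul, hexp, ← Real.exp_add]
  simp

end Doeblin

end SubMarkovSemigroup

/-! ### Powers and exponential of the Green operator -/

/-- Since `|a / b| ≤ 1`, the error can be divided by the explicit `e` instead of `b`, so no lower
bound on `b` is needed. The errors of numerator and denominator each contribute `r`. -/
lemma abs_div_sub_le {a b e w r : ℝ} (hb : 0 < b) (he : 0 < e) (hab : |a| ≤ b)
    (ha : |a - w * e| ≤ r) (hbe : |b - e| ≤ r) : |a / b - w| ≤ 2 * r / e := by
  have h1 : |a / b| ≤ 1 := by rwa [abs_div, abs_of_pos hb, div_le_one hb]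
  have h2 : a / b - w = ((a - w * e) - a / b * (b - e)) / e := by field_simp; ring
  rw [h2, abs_div, abs_of_pos he]
  refine div_le_div_of_nonneg_right ((abs_sub _ _).trans ?_) he.le
  rw [abs_mul]
  have h3 : |a / b| * |b - e| ≤ |b - e| := mul_le_of_le_one_left (abs_nonneg _) h1
  linarith

lemma abs_integral_sub_le_of_forall {E : Type*} [MeasurableSpace E] {f g : E → ℝ} {r : ℝ}
    (hf : IsBddMeas f) (hg : IsBddMeas g) (h : ∀ x, |f x - g x| ≤ r) (μ : Measure E)
    [IsProbabilityMeasure μ] : |∫ x, f x ∂μ - ∫ x, g x ∂μ| ≤ r := by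
  rw [← integral_sub (hf.integrable μ) (hg.integrable μ)]
  have := norm_integral_le_of_norm_le_const (μ := μ) (f := fun x => f x - g x)
    (Eventually.of_forall h)
  simpa using this

lemma abs_integral_le_of_forall {E : Type*} [MeasurableSpace E] {f g : E → ℝ}
    (hg : IsBddMeas g) (h : ∀ x, |f x| ≤ g x) (μ : Measure E) [IsFiniteMeasure μ] :
    |∫ x, f x ∂μ| ≤ ∫ x, g x ∂μ :=
  norm_integral_le_of_norm_le (f := f) (hg.integrable μ) (Eventually.of_forall h)

lemma hasSum_pow_div_factorial_mul (t a c : ℝ) :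
    HasSum (fun n : ℕ => t ^ n / (n.factorial : ℝ) * (c * a ^ n)) (c * Real.exp (t * a)) := by
  have h := NormedSpace.expSeries_div_hasSum_exp (t * a)
  rw [← Real.exp_eq_exp_ℝ] at h
  refine (h.mul_left c).congr_fun fun n => ?_
  simp only [mul_pow]
  ring

namespace SubMarkovSemigroup

variable {E : Type*} [MeasurableSpace E] (S : SubMarkovSemigroup E)

/-- The Green operator. -/
def green (f : E → ℝ) (x : E) : ℝ := ∫ s in Set.Ioi (0 : ℝ), S.op s.toNNReal f x

/-- The exponential of the Green operator. -/
def expGreen (t : ℝ) (f : E → ℝ) (x : E) : ℝ :=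
  ∑' n : ℕ, t ^ n / (n.factorial : ℝ) * (S.green^[n] f) x

lemma measurable_op_toNNReal {f : E → ℝ} (hf : Measurable f) :
    Measurable fun p : E × ℝ => S.op p.2.toNNReal f p.1 :=
  (S.measurable_op_uncurry hf).comp
    ((measurable_real_toNNReal.comp measurable_snd).prodMk measurable_fst)

lemma measurable_green {f : E → ℝ} (hf : Measurable f) : Measurable (S.green f) :=
  ((S.measurable_op_toNNReal hf).stronglyMeasurable.integral_prod_right).measurable

lemma op_pos (hpos : ∀ t x, 0 < S.surv t x) {f : E → ℝ} (hf : IsBddMeas f) (h : ∀ x, 0 < f x)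
    (t : ℝ≥0) (x : E) : 0 < S.op t f x := by
  rw [op, integral_pos_iff_support_of_nonneg (fun x => (h x).le) (hf.integrable _),
    Set.eq_univ_of_forall fun x => Function.mem_support.2 (h x).ne']
  have := hpos t x
  rw [surv_eq, measureReal_def] at this
  exact (ENNReal.toReal_pos_iff.1 this).1

namespace SpectralData

variable {S} {α : Measure E} {η : E → ℝ} {lam γ C C' C'' : ℝ}

lemma one_le (D : S.SpectralData α η lam γ C C' C'') (x : E) : 1 ≤ C'' := by
  have := D.surv_le x 0
  simpa [surv, S.op_zero measurable_one] using this

lemma nonempty (D : S.SpectralData α η lam γ C C' C'') : Nonempty E := by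
  have := D.prob
  exact α.nonempty_of_neZero

lemma C''_pos (D : S.SpectralData α η lam γ C C' C'') : 0 < C'' := by
  obtain ⟨x⟩ := D.nonempty
  linarith [D.one_le x]

lemma C'_nonneg (D : S.SpectralData α η lam γ C C' C'') : 0 ≤ C' := by
  obtain ⟨x⟩ := D.nonempty
  simpa using (abs_nonneg _).trans (D.η_approx x 0)

lemma abs_op_le_exp (D : S.SpectralData α η lam γ C C' C'')
    {f : E → ℝ} {M : ℝ} (hM : ∀ x, |f x| ≤ M) (t : ℝ≥0) (x : E) :
    |S.op t f x| ≤ M * (C'' * Real.exp (-lam * t)) :=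
  (S.abs_op_le hM t x).trans
    (mul_le_mul_of_nonneg_left (D.surv_le x t) ((abs_nonneg _).trans (hM x)))

lemma integrableOn_exp (D : S.SpectralData α η lam γ C C' C'') (M : ℝ) :
    IntegrableOn (fun s : ℝ => M * (C'' * Real.exp (-lam * s))) (Set.Ioi 0) :=
  ((integrableOn_exp_mul_Ioi (neg_neg_of_pos D.lam_pos) 0).const_mul C'').const_mul M

lemma integrableOn_op (D : S.SpectralData α η lam γ C C' C'')
    {f : E → ℝ} (hf : IsBddMeas f) (x : E) :
    IntegrableOn (fun s : ℝ => S.op s.toNNReal f x) (Set.Ioi 0) := by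
  obtain ⟨M, hM⟩ := hf.2
  refine (D.integrableOn_exp M).mono'
    ((S.measurable_op_toNNReal hf.1).comp measurable_prodMk_left).aestronglyMeasurable ?_
  refine (ae_restrict_iff' measurableSet_Ioi).2 (Eventually.of_forall fun s hs => ?_)
  have := D.abs_op_le_exp hM s.toNNReal x
  rwa [Real.coe_toNNReal s (le_of_lt hs)] at this

lemma abs_green_le (D : S.SpectralData α η lam γ C C' C'')
    {f : E → ℝ} {M : ℝ} (hM : ∀ x, |f x| ≤ M) (x : E) :
    |S.green f x| ≤ C'' / lam * M := by
  have h := norm_integral_le_of_norm_le (D.integrableOn_exp M)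
    (f := fun s : ℝ => S.op s.toNNReal f x)
    ((ae_restrict_iff' measurableSet_Ioi).2 (Eventually.of_forall fun s hs => by
      have := D.abs_op_le_exp hM s.toNNReal x
      rwa [Real.coe_toNNReal s (le_of_lt hs)] at this))
  rw [integral_const_mul, integral_const_mul,
    integral_exp_mul_Ioi (neg_neg_of_pos D.lam_pos)] at h
  refine h.trans_eq ?_
  have := D.lam_pos.ne'
  simp
  field_simp

lemma isBddMeas_green (D : S.SpectralData α η lam γ C C' C'')
    {f : E → ℝ} (hf : IsBddMeas f) : IsBddMeas (S.green f) := by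
  obtain ⟨M, hM⟩ := hf.2
  exact ⟨S.measurable_green hf.1, _, D.abs_green_le hM⟩

lemma isBddMeas_iterate (D : S.SpectralData α η lam γ C C' C'')
    {f : E → ℝ} (hf : IsBddMeas f) (n : ℕ) :
    IsBddMeas (S.green^[n] f) := by
  induction n with
  | zero => exact hf
  | succ n ih => rw [Function.iterate_succ_apply']; exact D.isBddMeas_green ih

lemma abs_iterate_le (D : S.SpectralData α η lam γ C C' C'')
    {f : E → ℝ} {M : ℝ} (hM : ∀ x, |f x| ≤ M) (n : ℕ) (x : E) :
    |(S.green^[n] f) x| ≤ M * (C'' / lam) ^ n := by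
  induction n generalizing x with
  | zero => simpa using hM x
  | succ n ih =>
    rw [Function.iterate_succ_apply']
    exact (D.abs_green_le ih x).trans_eq (by ring)

lemma abs_green_le_green (D : S.SpectralData α η lam γ C C' C'')
    {f g : E → ℝ} (hg : IsBddMeas g) (h : ∀ x, |f x| ≤ g x) (x : E) :
    |S.green f x| ≤ S.green g x :=
  norm_integral_le_of_norm_le (f := fun s : ℝ => S.op s.toNNReal f x) (D.integrableOn_op hg x)
    (Eventually.of_forall fun _ => abs_integral_le_of_forall hg h _)

/-- Positivity of the Green operator; this is the hypothesis `|a| ≤ b` of `abs_div_sub_le` for the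
normalized powers. -/
lemma abs_iterate_le_iterate_one (D : S.SpectralData α η lam γ C C' C'')
    {f : E → ℝ} (h : ∀ x, |f x| ≤ 1) (n : ℕ) (x : E) :
    |(S.green^[n] f) x| ≤ (S.green^[n] 1) x := by
  induction n generalizing x with
  | zero => exact h x
  | succ n ih =>
    rw [Function.iterate_succ_apply', Function.iterate_succ_apply']
    exact D.abs_green_le_green (D.isBddMeas_iterate .one n) ih x

lemma green_pos (D : S.SpectralData α η lam γ C C' C'')
    (hpos : ∀ t x, 0 < S.surv t x) {f : E → ℝ} (hf : IsBddMeas f)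
    (h : ∀ x, 0 < f x) (x : E) : 0 < S.green f x := by
  have hp := fun s : ℝ => S.op_pos hpos hf h s.toNNReal x
  rw [green, integral_pos_iff_support_of_nonneg (fun s => (hp s).le) (D.integrableOn_op hf x),
    Set.eq_univ_of_forall fun s => Function.mem_support.2 (hp s).ne']
  simp

lemma iterate_one_pos (D : S.SpectralData α η lam γ C C' C'')
    (hpos : ∀ t x, 0 < S.surv t x) (n : ℕ) (x : E) :
    0 < (S.green^[n] 1) x := by
  induction n generalizing x with
  | zero => exact one_pos
  | succ n ih =>
    rw [Function.iterate_succ_apply']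
    exact D.green_pos hpos (D.isBddMeas_iterate .one n) ih x

/-- Fubini and the semigroup property; `M C'' exp (-λ₀ s)` dominates, and `P_t(x, ·)` is finite. -/
lemma op_green (D : S.SpectralData α η lam γ C C' C'')
    {f : E → ℝ} (hf : IsBddMeas f) (t : ℝ≥0) (x : E) :
    S.op t (S.green f) x = ∫ s in Set.Ioi (0 : ℝ), S.op (t + s.toNNReal) f x := by
  obtain ⟨M, hM⟩ := hf.2
  have hint : Integrable (Function.uncurry fun (y : E) (s : ℝ) => S.op s.toNNReal f y)
      ((S.P (t, x)).prod (volume.restrict (Set.Ioi 0))) := by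
    refine Integrable.mono' (Integrable.comp_snd (D.integrableOn_exp M) _)
      (S.measurable_op_toNNReal hf.1).aestronglyMeasurable ?_
    have hs : ∀ᵐ s ∂(volume.restrict (Set.Ioi (0 : ℝ))), 0 < s :=
      ae_restrict_mem measurableSet_Ioi
    filter_upwards [Measure.quasiMeasurePreserving_snd.ae hs] with p hp
    have := D.abs_op_le_exp hM p.2.toNNReal p.1
    rwa [Real.coe_toNNReal _ (le_of_lt hp)] at this
  have := integral_integral_swap hint
  rw [op]
  refine this.trans (integral_congr_ae (Eventually.of_forall fun s => ?_))
  exact (S.op_add hf t s.toNNReal x).symm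

/-- Replacing the conditional expectation by `α(f)` costs `C`, multiplied by the bound `C''` on
survival; replacing the rescaled survival probability by `η` costs `C'`. -/
lemma abs_op_sub_le (D : S.SpectralData α η lam γ C C' C'')
    (hpos : ∀ t x, 0 < S.surv t x) {f : E → ℝ} (hf : IsBddMeas f) {M : ℝ}
    (hM : ∀ x, |f x| ≤ M) (t : ℝ≥0) (x : E) :
    |S.op t f x - Real.exp (-lam * t) * ((∫ y, f y ∂α) * η x)| ≤
      (C * C'' + C') * M * Real.exp (-(lam + γ) * t) := by
  have := D.prob
  have hM0 : 0 ≤ M := (abs_nonneg _).trans (hM x)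
  have h1 := abs_integral_sub_le_of_unit_ball
    (fun f hf hf1 => D.tv_le (Measure.dirac x) inferInstance f hf hf1 t) hf.1 hM0 hM
  have hα : |∫ y, f y ∂α| ≤ M := by
    have := norm_integral_le_of_norm_le_const (μ := α) (f := f) (Eventually.of_forall hM)
    simpa using this
  rw [op_eq_surv_mul_integral_cond hpos hf]
  set w := ∫ y, f y ∂α
  set v := ∫ y, f y ∂(S.cond (Measure.dirac x) t)
  have e0 : Real.exp (-lam * t) * Real.exp (lam * t) = 1 := by rw [← Real.exp_add]; simp
  have e1 : S.surv t x * v - Real.exp (-lam * t) * (w * η x) = S.surv t x * (v - w) +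
      w * (Real.exp (-lam * t) * (Real.exp (lam * t) * S.surv t x - η x)) := by
    linear_combination (- w * S.surv t x) * e0
  have e2 : Real.exp (-(lam + γ) * t) = Real.exp (-lam * t) * Real.exp (-γ * t) := by
    rw [← Real.exp_add]; ring_nf
  have a1 : |S.surv t x * (v - w)| ≤
      C'' * Real.exp (-lam * t) * (M * (C * Real.exp (-γ * t))) := by
    rw [abs_mul, abs_of_nonneg (S.surv_nonneg t x)]
    exact mul_le_mul (D.surv_le x t) h1 (abs_nonneg _)
      (mul_nonneg D.C''_pos.le (Real.exp_pos _).le)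
  have a2 : |w * (Real.exp (-lam * t) * (Real.exp (lam * t) * S.surv t x - η x))| ≤
      M * (Real.exp (-lam * t) * (C' * Real.exp (-γ * t))) := by
    rw [abs_mul, abs_mul, Real.abs_exp]
    exact mul_le_mul hα (mul_le_mul_of_nonneg_left (D.η_approx x t) (Real.exp_pos _).le)
      (by positivity) hM0
  rw [e1, e2]
  refine (abs_add_le _ _).trans ((add_le_add a1 a2).trans_eq (by ring))

/-- The time `t` is kept so that the induction closes: by `op_green` the next power is the integral
of the present estimate over the times `t + s`. -/
lemma abs_op_iterate_sub_le (D : S.SpectralData α η lam γ C C' C'')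
    (hpos : ∀ t x, 0 < S.surv t x) {f : E → ℝ} (hf : IsBddMeas f) {M : ℝ}
    (hM : ∀ x, |f x| ≤ M) (n : ℕ) (t : ℝ≥0) (x : E) :
    |S.op t (S.green^[n] f) x - Real.exp (-lam * t) * ((∫ y, f y ∂α) * η x / lam ^ n)| ≤
      (C * C'' + C') * M / (lam + γ) ^ n * Real.exp (-(lam + γ) * t) := by
  induction n generalizing t with
  | zero => simpa using D.abs_op_sub_le hpos hf hM t x
  | succ n ih =>
    have hlg : 0 < lam + γ := add_pos D.lam_pos D.γ_pos
    set w := (∫ y, f y ∂α) * η x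
    set R := (C * C'' + C') * M
    have hg := D.isBddMeas_iterate hf n
    -- Used with `a = λ₀` for the main term and `a = λ₀ + γ` for the error; each integration
    -- contributes one factor `1 / a`.
    have hexp : ∀ {a : ℝ}, 0 < a → ∀ c : ℝ,
        IntegrableOn (fun s : ℝ => c * Real.exp (-a * (t + s))) (Set.Ioi 0) ∧
        ∫ s in Set.Ioi (0 : ℝ), c * Real.exp (-a * (t + s)) = Real.exp (-a * t) * c / a := by
      intro a ha c
      have e : (fun s : ℝ => c * Real.exp (-a * (t + s))) =
          fun s => (c * Real.exp (-a * t)) * Real.exp (-a * s) := by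
        ext s; rw [mul_add, Real.exp_add]; ring
      rw [e]
      refine ⟨(integrableOn_exp_mul_Ioi (neg_neg_of_pos ha) 0).const_mul _, ?_⟩
      rw [integral_const_mul, integral_exp_mul_Ioi (neg_neg_of_pos ha)]
      simp
      field_simp
    obtain ⟨i1, v1⟩ := hexp D.lam_pos (w / lam ^ n)
    obtain ⟨i2, v2⟩ := hexp hlg (R / (lam + γ) ^ n)
    have i0 : IntegrableOn (fun s : ℝ => S.op (t + s.toNNReal) (S.green^[n] f) x)
        (Set.Ioi 0) := by
      obtain ⟨K, hK⟩ := hg.2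
      obtain ⟨i3, -⟩ := hexp D.lam_pos (K * C'')
      refine i3.mono' ((S.measurable_op_uncurry hg.1).comp
        ((measurable_real_toNNReal.const_add t).prodMk measurable_const)).aestronglyMeasurable ?_
      refine (ae_restrict_iff' measurableSet_Ioi).2 (Eventually.of_forall fun s hs => ?_)
      have := D.abs_op_le_exp hK (t + s.toNNReal) x
      rwa [NNReal.coe_add, Real.coe_toNNReal s (le_of_lt hs), ← mul_assoc] at this
    rw [Function.iterate_succ_apply', D.op_green hg]
    have e1 : Real.exp (-lam * t) * (w / lam ^ (n + 1)) =
        ∫ s in Set.Ioi (0 : ℝ), w / lam ^ n * Real.exp (-lam * (t + s)) := by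
      rw [v1, pow_succ]; have := D.lam_pos.ne'; field_simp
    have e2 : R / (lam + γ) ^ (n + 1) * Real.exp (-(lam + γ) * t) =
        ∫ s in Set.Ioi (0 : ℝ), R / (lam + γ) ^ n * Real.exp (-(lam + γ) * (t + s)) := by
      rw [v2, pow_succ]; field_simp
    rw [e1, e2, ← integral_sub i0 i1]
    rw [← Real.norm_eq_abs]
    refine norm_integral_le_of_norm_le i2
      ((ae_restrict_iff' measurableSet_Ioi).2 (Eventually.of_forall fun s hs => ?_))
    have := ih (t + s.toNNReal)
    rw [NNReal.coe_add, Real.coe_toNNReal s (le_of_lt hs)] at this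
    rw [Real.norm_eq_abs, mul_comm (w / lam ^ n)]
    exact this

/-- The powers of the Green operator are asymptotically of rank one. -/
theorem abs_iterate_sub_le (D : S.SpectralData α η lam γ C C' C'')
    (hpos : ∀ t x, 0 < S.surv t x) {f : E → ℝ} (hf : IsBddMeas f) {M : ℝ}
    (hM : ∀ x, |f x| ≤ M) (n : ℕ) (x : E) :
    |(S.green^[n] f) x - (∫ y, f y ∂α) * η x / lam ^ n| ≤
      (C * C'' + C') * M / (lam + γ) ^ n := by
  have := D.abs_op_iterate_sub_le hpos hf hM n 0 x
  simpa [S.op_zero (D.isBddMeas_iterate hf n).1] using this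

lemma norm_term_le (D : S.SpectralData α η lam γ C C' C'')
    {f : E → ℝ} {M : ℝ} (hM : ∀ x, |f x| ≤ M) (t : ℝ) (x : E) (n : ℕ) :
    ‖t ^ n / (n.factorial : ℝ) * (S.green^[n] f) x‖ ≤
      |t| ^ n / (n.factorial : ℝ) * (M * (C'' / lam) ^ n) := by
  rw [norm_mul, norm_div, norm_pow, Real.norm_eq_abs, Real.norm_natCast]
  exact mul_le_mul_of_nonneg_left (D.abs_iterate_le hM n x) (by positivity)

lemma summable_exp (D : S.SpectralData α η lam γ C C' C'')
    {f : E → ℝ} (hf : IsBddMeas f) (t : ℝ) (x : E) :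
    Summable fun n : ℕ => t ^ n / (n.factorial : ℝ) * (S.green^[n] f) x := by
  obtain ⟨M, hM⟩ := hf.2
  exact Summable.of_norm_bounded (hasSum_pow_div_factorial_mul _ _ _).summable (D.norm_term_le hM t x)

lemma isBddMeas_expGreen (D : S.SpectralData α η lam γ C C' C'')
    {f : E → ℝ} (hf : IsBddMeas f) (t : ℝ) : IsBddMeas (S.expGreen t f) := by
  obtain ⟨M, hM⟩ := hf.2
  refine ⟨?_, _, fun x => tsum_of_norm_bounded (hasSum_pow_div_factorial_mul _ _ _) (D.norm_term_le hM t x)⟩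
  refine measurable_of_tendsto_metrizable (f := fun (N : ℕ) x =>
    ∑ n ∈ Finset.range N, t ^ n / (n.factorial : ℝ) * (S.green^[n] f) x) (fun N => ?_)
    (tendsto_pi_nhds.2 fun x => (D.summable_exp hf t x).hasSum.tendsto_sum_nat)
  exact Finset.measurable_fun_sum _ fun n _ => (D.isBddMeas_iterate hf n).1.const_mul _

lemma abs_expGreen_le (D : S.SpectralData α η lam γ C C' C'')
    {f : E → ℝ} (h : ∀ x, |f x| ≤ 1) {t : ℝ} (ht : 0 ≤ t)
    (x : E) : |S.expGreen t f x| ≤ S.expGreen t 1 x := by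
  rw [expGreen, ← Real.norm_eq_abs]
  refine tsum_of_norm_bounded (D.summable_exp .one t x).hasSum fun n => ?_
  rw [norm_mul, Real.norm_eq_abs, Real.norm_eq_abs, abs_of_nonneg (by positivity)]
  exact mul_le_mul_of_nonneg_left (D.abs_iterate_le_iterate_one h n x) (by positivity)

lemma expGreen_one_pos (D : S.SpectralData α η lam γ C C' C'')
    (hpos : ∀ t x, 0 < S.surv t x) {t : ℝ} (ht : 0 ≤ t) (x : E) :
    0 < S.expGreen t 1 x := by
  refine (D.summable_exp .one t x).tsum_pos (fun n => ?_) 0 ?_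
  · exact mul_nonneg (by positivity) (D.iterate_one_pos hpos n x).le
  · simp

theorem abs_expGreen_sub_le (D : S.SpectralData α η lam γ C C' C'')
    (hpos : ∀ t x, 0 < S.surv t x) {f : E → ℝ} (hf : IsBddMeas f) {M : ℝ}
    (hM : ∀ x, |f x| ≤ M) {t : ℝ} (ht : 0 ≤ t) (x : E) :
    |S.expGreen t f x - (∫ y, f y ∂α) * η x * Real.exp (t * lam⁻¹)| ≤
      (C * C'' + C') * M * Real.exp (t * (lam + γ)⁻¹) := by
  have h1 := hasSum_pow_div_factorial_mul t lam⁻¹ ((∫ y, f y ∂α) * η x)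
  have h2 := hasSum_pow_div_factorial_mul t (lam + γ)⁻¹ ((C * C'' + C') * M)
  have h3 := (D.summable_exp hf t x).hasSum.sub h1
  rw [expGreen, ← h3.tsum_eq, ← Real.norm_eq_abs]
  refine tsum_of_norm_bounded h2 fun n => ?_
  rw [← mul_sub, norm_mul, Real.norm_eq_abs, Real.norm_eq_abs, abs_of_nonneg (by positivity)]
  refine mul_le_mul_of_nonneg_left ?_ (by positivity)
  simpa [div_eq_mul_inv] using D.abs_iterate_sub_le hpos hf hM n x

/-- Integrating (A2) against `α` gives `ν(P_n 1) ≥ c₂ exp (-λ₀ n)`. Inserted into (A1), this keeps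
the rescaled survival probability at time `t₀ + n` above a constant `c > 0` for every `n`, and `η x`
is its limit. -/
lemma η_pos (D : S.SpectralData α η lam γ C C' C'')
    {ν : Measure E} {t₀ : ℝ≥0} {c₁ c₂ : ℝ} (H : S.Doeblin ν t₀ c₁ c₂) (x : E) :
    0 < η x := by
  have := D.prob
  have := H.prob
  set c := c₁ * c₂ * (Real.exp (lam * t₀) * S.surv t₀ x) with hc
  have hc0 : 0 < c := mul_pos (mul_pos H.c₁_pos H.c₂_pos)
    (mul_pos (Real.exp_pos _) (H.surv_pos t₀ x))
  have hν : ∀ t : ℝ≥0, c₂ * Real.exp (-lam * t) ≤ ∫ y, S.surv t y ∂ν := fun t => by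
    have h := integral_mono (((S.isBddMeas_surv t).const_mul c₂).integrable α)
      (integrable_const _) fun y => H.survive t y
    rwa [integral_const_mul, D.integral_surv, integral_const, probReal_univ, one_smul] at h
  have hle : ∀ n : ℕ, c - C' * Real.exp (-γ * t₀) * Real.exp (-γ * n) ≤ η x := by
    intro n
    have h1 := H.minor x _ (S.isBddMeas_surv n) (S.surv_nonneg n)
    rw [← surv_add] at h1
    have h2 := mul_le_mul_of_nonneg_left (hν n)
      (mul_nonneg H.c₁_pos.le (S.surv_nonneg t₀ x))
    have h3 := mul_le_mul_of_nonneg_left (h2.trans h1) (Real.exp_pos (lam * (t₀ + n : ℝ≥0))).le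
    have h4 := (abs_le.1 (D.η_approx x (t₀ + n))).2
    have e0 : Real.exp (lam * n) * Real.exp (-lam * n) = 1 := by rw [← Real.exp_add]; simp
    push_cast at h3 h4
    rw [mul_add, Real.exp_add] at h3
    have e1 : Real.exp (-γ * (t₀ + n)) = Real.exp (-γ * t₀) * Real.exp (-γ * n) := by
      rw [mul_add, Real.exp_add]
    rw [e1, mul_add, Real.exp_add] at h4
    have e2 : Real.exp (lam * t₀) * Real.exp (lam * n) *
        (c₁ * S.surv t₀ x * (c₂ * Real.exp (-lam * n))) = c := by
      rw [hc]
      linear_combination (c₁ * c₂ * Real.exp (lam * t₀) * S.surv t₀ x) * e0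
    rw [e2] at h3
    linarith
  have hlim := (tendsto_exp_neg_mul_nat D.γ_pos (C' * Real.exp (-γ * t₀))).const_sub c
  rw [sub_zero] at hlim
  exact hc0.trans_le (le_of_tendsto' hlim hle)

section Normalized

variable (μ : Measure E) [IsProbabilityMeasure μ]

theorem abs_integral_iterate_sub_le (D : S.SpectralData α η lam γ C C' C'')
    (hpos : ∀ t x, 0 < S.surv t x) {f : E → ℝ}
    (hf : IsBddMeas f) {M : ℝ} (hM : ∀ x, |f x| ≤ M) (n : ℕ) :
    |∫ x, (S.green^[n] f) x ∂μ - (∫ x, f x ∂α) * (∫ x, η x ∂μ) / lam ^ n| ≤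
      (C * C'' + C') * M / (lam + γ) ^ n := by
  have := abs_integral_sub_le_of_forall (D.isBddMeas_iterate hf n)
    (D.η_bddMeas.const_mul ((∫ x, f x ∂α) / lam ^ n))
    (fun x => by
      rw [div_mul_eq_mul_div]; exact D.abs_iterate_sub_le hpos hf hM n x) μ
  rwa [integral_const_mul, div_mul_eq_mul_div] at this

theorem abs_normalized_iterate_sub_le (D : S.SpectralData α η lam γ C C' C'')
    (hpos : ∀ t x, 0 < S.surv t x) {f : E → ℝ}
    (hf : Measurable f) (hf1 : ∀ x, |f x| ≤ 1) (n : ℕ) (hη : 0 < ∫ x, η x ∂μ) :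
    |(∫ x, (S.green^[n] f) x ∂μ) / (∫ x, (S.green^[n] 1) x ∂μ) - ∫ x, f x ∂α| ≤
      2 * (C * C'' + C') / (∫ x, η x ∂μ) * (lam / (lam + γ)) ^ n := by
  have := D.prob
  have hl := pow_pos D.lam_pos n
  have hlg := add_pos D.lam_pos D.γ_pos
  have h1 := D.abs_integral_iterate_sub_le μ hpos ⟨hf, 1, hf1⟩ hf1 n
  have h2 := D.abs_integral_iterate_sub_le μ hpos .one (M := 1) (by simp) n
  simp only [Pi.one_apply, integral_const, probReal_univ, smul_eq_mul, one_mul] at h2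
  have hA := D.isBddMeas_iterate .one n
  refine (abs_div_sub_le (integral_pos_of_forall_pos hA (D.iterate_one_pos hpos n) μ)
    (div_pos hη hl) (abs_integral_le_of_forall hA (D.abs_iterate_le_iterate_one hf1 n) μ)
    (by rwa [← mul_div_assoc]) h2).trans_eq ?_
  rw [div_pow]
  field_simp

theorem abs_normalized_exp_sub_le (D : S.SpectralData α η lam γ C C' C'')
    (hpos : ∀ t x, 0 < S.surv t x) {f : E → ℝ}
    (hf : Measurable f) (hf1 : ∀ x, |f x| ≤ 1) {t : ℝ} (ht : 0 ≤ t) (hη : 0 < ∫ x, η x ∂μ) :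
    |(∫ x, S.expGreen t f x ∂μ) / (∫ x, S.expGreen t 1 x ∂μ) - ∫ x, f x ∂α| ≤
      2 * (C * C'' + C') / (∫ x, η x ∂μ) * Real.exp (-t * (γ / (lam * (lam + γ)))) := by
  have := D.prob
  have hl := D.lam_pos
  have hlg := add_pos D.lam_pos D.γ_pos
  have key : ∀ {g : E → ℝ}, Measurable g → (∀ x, |g x| ≤ 1) →
      |∫ x, S.expGreen t g x ∂μ - (∫ x, g x ∂α) * ((∫ x, η x ∂μ) * Real.exp (t * lam⁻¹))| ≤
        (C * C'' + C') * Real.exp (t * (lam + γ)⁻¹) := by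
    intro g hg hg1
    have := abs_integral_sub_le_of_forall (D.isBddMeas_expGreen ⟨hg, 1, hg1⟩ t)
      (D.η_bddMeas.const_mul ((∫ x, g x ∂α) * Real.exp (t * lam⁻¹)))
      (fun x => by
        rw [mul_right_comm]; exact D.abs_expGreen_sub_le hpos ⟨hg, 1, hg1⟩ hg1 ht x) μ
    rw [integral_const_mul, mul_one] at this
    rwa [mul_comm (∫ x, η x ∂μ), ← mul_assoc]
  have h2 := key (g := 1) measurable_one (by simp)
  simp only [Pi.one_apply, integral_const, probReal_univ, smul_eq_mul, one_mul] at h2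
  have hA := D.isBddMeas_expGreen .one t
  refine (abs_div_sub_le (integral_pos_of_forall_pos hA (D.expGreen_one_pos hpos ht) μ)
    (mul_pos hη (Real.exp_pos _)) (abs_integral_le_of_forall hA (D.abs_expGreen_le hf1 ht) μ)
    (key hf hf1) h2).trans_eq ?_
  -- The rate is the gap `1 / λ₀ - 1 / (λ₀ + γ)`.
  have e : Real.exp (-t * (γ / (lam * (lam + γ)))) =
      Real.exp (t * (lam + γ)⁻¹) / Real.exp (t * lam⁻¹) := by
    rw [← Real.exp_sub]
    congr 1
    field_simp
    ring
  rw [e]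
  field_simp

end Normalized

end SpectralData

end SubMarkovSemigroup

/-! ### From the absorbed process to its semigroup -/

lemma measurableEmbedding_inl {E : Type*} [MeasurableSpace E] :
    MeasurableEmbedding (Sum.inl : E → WithCemetery E) :=
  ⟨Sum.inl_injective, measurable_inl, fun _ hs => hs.inl_image⟩

lemma map_comap_inl {E : Type*} [MeasurableSpace E] (m : Measure (WithCemetery E)) :
    (m.comap Sum.inl).map Sum.inl = m.restrict (Set.range (Sum.inl : E → WithCemetery E)) :=
  measurableEmbedding_inl.map_comap m

lemma comap_inl_apply {E : Type*} [MeasurableSpace E] (m : Measure (WithCemetery E)) {B : Set E}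
    (hB : MeasurableSet B) : m.comap Sum.inl B = m (Sum.inl '' B) :=
  Measure.comap_apply _ Sum.inl_injective
    (fun _ hs => hs.inl_image) _ hB

lemma lintegral_comap_inl {E : Type*} [MeasurableSpace E] (m : Measure (WithCemetery E))
    {g : WithCemetery E → ℝ≥0∞} (hg : g cemetery = 0) :
    ∫⁻ y, g (Sum.inl y) ∂(m.comap Sum.inl) = ∫⁻ z, g z ∂m := by
  rw [← measurableEmbedding_inl.lintegral_map, map_comap_inl,
    setLIntegral_eq_of_support_subset]
  rintro (x | ⟨⟩) hx
  · exact ⟨x, rfl⟩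
  · exact absurd hg hx

lemma integral_comap_inl {E : Type*} [MeasurableSpace E] (m : Measure (WithCemetery E))
    {g : WithCemetery E → ℝ} (hg : g cemetery = 0) :
    ∫ y, g (Sum.inl y) ∂(m.comap Sum.inl) = ∫ z, g z ∂m := by
  rw [← measurableEmbedding_inl.integral_map, map_comap_inl,
    setIntegral_eq_integral_of_forall_compl_eq_zero]
  rintro (x | ⟨⟩) hx
  · exact absurd ⟨x, rfl⟩ hx
  · exact hg

namespace AbsorbedMarkovProcess

variable {E Ω : Type*} [MeasurableSpace E] [MeasurableSpace Ω] (𝕏 : AbsorbedMarkovProcess E Ω)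

instance : IsMarkovKernel 𝕏.law := 𝕏.isMarkovKernel

lemma measurable_X (t : ℝ≥0) : Measurable (𝕏.X t) := 𝕏.measurable.comp measurable_prodMk_left

lemma measurableSet_preimage_image (t : ℝ≥0) {B : Set E} (hB : MeasurableSet B) :
    MeasurableSet (𝕏.X t ⁻¹' (Sum.inl '' B)) :=
  𝕏.measurable_X t hB.inl_image

lemma τ_le {t : ℝ≥0} {ω : Ω} (h : 𝕏.X t ω = cemetery) : 𝕏.τ ω ≤ t := iInf₂_le t h

/-- Up to null sets, survival up to time `t` means that the process is in `E` at time `t`. -/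
lemma alive_ae_eq (m : Measure (WithCemetery E)) [IsProbabilityMeasure m] (t : ℝ≥0) :
    {ω | (t : ℝ≥0∞) < 𝕏.τ ω} =ᵐ[m.bind 𝕏.law]
      𝕏.X t ⁻¹' (Sum.inl '' (Set.univ : Set E)) := by
  -- Only the inclusion of `{X_t ∈ E}` in `{t < τ_∂}` needs absorption; the other one is the
  -- definition of the infimum.
  filter_upwards [𝕏.absorbed m inferInstance] with ω hω
  refine propext ⟨fun h => ?_, fun h => ?_⟩
  · rcases hX : 𝕏.X t ω with x | ⟨⟩
    · exact ⟨x, trivial, hX.symm⟩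
    · exact absurd (𝕏.τ_le hX) (not_le.2 h)
  · obtain ⟨x, -, hx⟩ := h
    refine lt_of_not_ge fun hle => ?_
    rw [hω t hle] at hx
    exact Sum.inl_ne_inr hx

/-- The law of `X_t` under `ℙ_x`, as a kernel in `(t, x)`. -/
def position : Kernel (ℝ≥0 × E) (WithCemetery E) :=
  ((Kernel.deterministic Prod.fst measurable_fst) ×ₖ
    (𝕏.law.comap (fun p : ℝ≥0 × E => Sum.inl p.2) (measurable_inl.comp measurable_snd))).map
    (fun p : ℝ≥0 × Ω => 𝕏.X p.1 p.2)

lemma position_apply (t : ℝ≥0) (x : E) : 𝕏.position (t, x) = (𝕏.pr x).map (𝕏.X t) := by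
  rw [position, Kernel.map_apply _ 𝕏.measurable, Kernel.prod_apply, Kernel.deterministic_apply,
    Kernel.comap_apply, Measure.dirac_prod, Measure.map_map 𝕏.measurable measurable_prodMk_left]
  rfl

/-- The transition kernels `P_t(x, B) = ℙ_x(X_t ∈ B)` of the process before absorption. -/
def transition : Kernel (ℝ≥0 × E) E := 𝕏.position.comapRight measurableEmbedding_inl

lemma transition_apply (t : ℝ≥0) (x : E) :
    𝕏.transition (t, x) = ((𝕏.pr x).map (𝕏.X t)).comap Sum.inl := by
  rw [transition, Kernel.comapRight_apply, position_apply]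

lemma transition_apply' (t : ℝ≥0) (x : E) {B : Set E} (hB : MeasurableSet B) :
    𝕏.transition (t, x) B = 𝕏.pr x (𝕏.X t ⁻¹' (Sum.inl '' B)) := by
  rw [transition_apply, comap_inl_apply _ hB,
    Measure.map_apply (𝕏.measurable_X t) hB.inl_image]

/-- From the cemetery, `τ_∂ = 0` almost surely. Hence the cemetery contributes nothing to the Markov
property, and Chapman-Kolmogorov holds on `E` alone. -/
lemma law_cemetery_alive (t : ℝ≥0) (B : Set E) :
    𝕏.law cemetery (𝕏.X t ⁻¹' (Sum.inl '' B)) = 0 := by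
  have h0 : ∀ᵐ ω ∂(𝕏.law cemetery), 𝕏.X 0 ω = cemetery := by
    have hs : MeasurableSet {z : WithCemetery E | z = cemetery} := by
      have : {z : WithCemetery E | z = cemetery} = Set.range Sum.inr := by
        ext (x | ⟨⟩) <;> simp
      rw [this]; exact measurableSet_range_inr
    rw [← ae_map_iff (𝕏.measurable_X 0).aemeasurable hs, 𝕏.start, ae_dirac_iff hs]
  have h1 := 𝕏.absorbed (Measure.dirac cemetery) inferInstance
  rw [Measure.dirac_bind 𝕏.law.measurable] at h1
  refine measure_eq_zero_iff_ae_notMem.2 ?_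
  filter_upwards [h0, h1] with ω hω h hmem
  obtain ⟨x, -, hx⟩ := hmem
  rw [h t ((𝕏.τ_le hω).trans (by simp))] at hx
  exact Sum.inl_ne_inr hx

/-- The sub-Markov semigroup of the process before absorption. -/
def toSemigroup : SubMarkovSemigroup E where
  P := 𝕏.transition
  mass_le := by
    rintro ⟨t, x⟩
    rw [𝕏.transition_apply' t x .univ]
    have : IsProbabilityMeasure (𝕏.pr x) := by unfold pr; infer_instance
    exact prob_le_one
  zero x := by
    rw [transition_apply, pr, 𝕏.start]
    refine Measure.ext fun B hB => ?_
    rw [comap_inl_apply _ hB, Measure.dirac_apply' _ hB,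
      Measure.dirac_apply' _ hB.inl_image]
    by_cases hx : x ∈ B <;> simp [hx]
  add s t x := by
    refine Measure.ext fun B hB => ?_
    have hC : MeasurableSet (Sum.inl '' B : Set (WithCemetery E)) := hB.inl_image
    have hm : Measurable fun y => 𝕏.transition (t, y) :=
      𝕏.transition.measurable.comp measurable_prodMk_left
    rw [𝕏.transition_apply' _ _ hB, Measure.bind_apply hB hm.aemeasurable, pr]
    -- With the trivial event the Markov property is Chapman-Kolmogorov on `E ∪ {∂}`.
    have h := 𝕏.markov (Sum.inl x) s t Set.univ (Sum.inl '' B) .univ hC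
    rw [Set.univ_inter, Measure.restrict_univ] at h
    rw [h, 𝕏.transition_apply]
    have hg : Measurable fun z => 𝕏.law z (𝕏.X t ⁻¹' (Sum.inl '' B)) :=
      𝕏.law.measurable_coe (𝕏.measurable_X t hC)
    rw [← lintegral_map hg (𝕏.measurable_X s), ← lintegral_comap_inl _ (𝕏.law_cemetery_alive t B)]
    exact lintegral_congr fun y => (𝕏.transition_apply' t y hB).symm

lemma prInit_alive (μ : Measure E) (t : ℝ≥0) {B : Set E} (hB : MeasurableSet B) :
    𝕏.prInit μ (𝕏.X t ⁻¹' (Sum.inl '' B)) = 𝕏.toSemigroup.push μ t B := by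
  have hX := 𝕏.measurableSet_preimage_image t hB
  rw [prInit, Measure.bind_apply hX 𝕏.law.measurable.aemeasurable,
    lintegral_map (𝕏.law.measurable_coe hX) measurable_inl, SubMarkovSemigroup.push,
    Measure.bind_apply hB (Kernel.measurable _).aemeasurable]
  exact lintegral_congr fun y => (𝕏.transition_apply' t y hB).symm

lemma alive_ae_eq_prInit (μ : Measure E) [IsProbabilityMeasure μ] (t : ℝ≥0) :
    {ω | (t : ℝ≥0∞) < 𝕏.τ ω} =ᵐ[𝕏.prInit μ] 𝕏.X t ⁻¹' (Sum.inl '' (Set.univ : Set E)) := by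
  have : IsProbabilityMeasure (μ.map (Sum.inl : E → WithCemetery E)) :=
    Measure.isProbabilityMeasure_map measurable_inl.aemeasurable
  exact 𝕏.alive_ae_eq _ t

/-- The possibly non-measurable survival event is exchanged for the measurable event `X_t ∈ E`,
which has the same conditional law. -/
lemma condLaw_prInit (μ : Measure E) [IsProbabilityMeasure μ] (t : ℝ≥0) :
    𝕏.condLaw (𝕏.prInit μ) t = 𝕏.toSemigroup.cond μ t := by
  have hA := 𝕏.alive_ae_eq_prInit μ t
  refine Measure.ext fun B hB => ?_
  have hX := 𝕏.measurableSet_preimage_image t hB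
  rw [condLaw, comap_inl_apply _ hB,
    Measure.map_apply (𝕏.measurable_X t) hB.inl_image,
    ProbabilityTheory.cond, measure_congr hA, Measure.restrict_congr_set hA, Measure.smul_apply,
    Measure.restrict_apply hX, 𝕏.prInit_alive μ t .univ,
    Set.inter_eq_left.2 (Set.preimage_mono (Set.image_mono (Set.subset_univ B))),
    𝕏.prInit_alive μ t hB]
  rfl

lemma survival_prInit (μ : Measure E) [IsProbabilityMeasure μ] (t : ℝ≥0) :
    𝕏.survival (𝕏.prInit μ) t = ∫ x, 𝕏.toSemigroup.surv t x ∂μ := by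
  rw [survival, measureReal_congr (𝕏.alive_ae_eq_prInit μ t), measureReal_def,
    𝕏.prInit_alive μ t .univ, ← measureReal_def, SubMarkovSemigroup.push_real_univ]

lemma prInit_dirac (x : E) : 𝕏.prInit (Measure.dirac x) = 𝕏.pr x := by
  rw [prInit, Measure.map_dirac' measurable_inl, Measure.dirac_bind 𝕏.law.measurable, pr]

lemma survival_pr (x : E) (t : ℝ≥0) : 𝕏.survival (𝕏.pr x) t = 𝕏.toSemigroup.surv t x := by
  rw [← prInit_dirac, survival_prInit,
    integral_dirac' _ _ (𝕏.toSemigroup.isBddMeas_surv t).1.stronglyMeasurable]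

lemma semigroup_eq {f : E → ℝ} (hf : Measurable f) (t : ℝ≥0) :
    𝕏.semigroup t f = 𝕏.toSemigroup.op t f := by
  ext x
  have hA := 𝕏.alive_ae_eq_prInit (Measure.dirac x) t
  rw [prInit_dirac] at hA
  have hg : Measurable (Sum.elim f (fun _ => 0) : WithCemetery E → ℝ) :=
    measurable_fun_sum hf measurable_const
  have h : 𝕏.semigroup t f x = ∫ ω, Sum.elim f (fun _ => 0) (𝕏.X t ω) ∂(𝕏.pr x) := by
    refine integral_congr_ae ((indicator_ae_eq_of_ae_eq_set hA).trans (.of_forall fun ω => ?_))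
    rcases hX : 𝕏.X t ω with y | ⟨⟩ <;> simp [Set.indicator, hX]
  rw [h, SubMarkovSemigroup.op]
  change _ = ∫ y, f y ∂(𝕏.transition (t, x))
  rw [transition_apply, ← integral_map (𝕏.measurable_X t).aemeasurable hg.aestronglyMeasurable,
    ← integral_comap_inl _ rfl]
  rfl

lemma green_eq {f : E → ℝ} (hf : Measurable f) : 𝕏.green f = 𝕏.toSemigroup.green f := by
  ext x
  simp only [green, SubMarkovSemigroup.green, 𝕏.semigroup_eq hf]

lemma green_iterate_eq {f : E → ℝ} (hf : Measurable f) (n : ℕ) :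
    𝕏.green^[n] f = 𝕏.toSemigroup.green^[n] f := by
  have hm : ∀ n, Measurable (𝕏.toSemigroup.green^[n] f) := fun n => by
    induction n with
    | zero => exact hf
    | succ n ih =>
      rw [Function.iterate_succ_apply']; exact 𝕏.toSemigroup.measurable_green ih
  induction n with
  | zero => rfl
  | succ n ih =>
    rw [Function.iterate_succ_apply', Function.iterate_succ_apply', ih, 𝕏.green_eq (hm n)]

lemma expGreen_eq {f : E → ℝ} (hf : Measurable f) (t : ℝ) :
    𝕏.expGreen t f = 𝕏.toSemigroup.expGreen t f := by
  ext x
  simp only [expGreen, SubMarkovSemigroup.expGreen, 𝕏.green_iterate_eq hf]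

/-- On almost every path `τ_∂` is finite, so the path is at the cemetery at all large integer times;
dominated convergence concludes. -/
lemma tendsto_surv_zero (hfin : ∀ x, ∀ᵐ ω ∂(𝕏.pr x), 𝕏.τ ω < ∞) (x : E) :
    Tendsto (fun n : ℕ => 𝕏.toSemigroup.surv n x) atTop (𝓝 0) := by
  have : IsProbabilityMeasure (𝕏.pr x) := by unfold pr; infer_instance
  have hX := fun n : ℕ => 𝕏.measurableSet_preimage_image n (.univ : MeasurableSet (Set.univ : Set E))
  have habs := 𝕏.absorbed (Measure.dirac (Sum.inl x)) inferInstance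
  rw [Measure.dirac_bind 𝕏.law.measurable] at habs
  have h := tendsto_integral_of_dominated_convergence (μ := 𝕏.pr x)
    (F := fun n : ℕ => (𝕏.X n ⁻¹' (Sum.inl '' (Set.univ : Set E))).indicator fun _ => (1 : ℝ))
    (f := fun _ => 0) (fun _ => 1)
    (fun n => (measurable_const.indicator (hX n)).aestronglyMeasurable) (integrable_const _)
    (fun n => .of_forall fun ω => by
      by_cases hω : ω ∈ 𝕏.X n ⁻¹' (Sum.inl '' (Set.univ : Set E)) <;>
        simp only [Set.indicator, hω, if_true, if_false] <;> simp)
    (by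
      filter_upwards [hfin x, habs] with ω hω h
      refine tendsto_const_nhds.congr' ?_
      obtain ⟨N, hN⟩ := ENNReal.exists_nat_gt hω.ne
      filter_upwards [eventually_ge_atTop N] with n hn
      refine (Set.indicator_of_notMem (fun hmem => ?_) _).symm
      obtain ⟨y, -, hy⟩ := hmem
      have hle : 𝕏.τ ω ≤ ((n : ℝ≥0) : ℝ≥0∞) :=
        hN.le.trans (by exact_mod_cast hn)
      rw [h n hle] at hy
      exact Sum.inl_ne_inr hy)
  simp only [integral_zero] at h
  refine h.congr fun n => ?_
  rw [integral_indicator (hX n), SubMarkovSemigroup.surv_eq]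
  change _ = (𝕏.transition _).real _
  rw [measureReal_def, 𝕏.transition_apply' _ _ .univ]
  simp [measureReal_def]

lemma doeblin {ν : Measure E} [IsProbabilityMeasure ν] {t₀ : ℝ≥0} {c₁ c₂ : ℝ}
    (hpos : ∀ (t : ℝ≥0) (x : E), 0 < 𝕏.survival (𝕏.pr x) t) (ht₀ : 0 < t₀) (hc₁ : 0 < c₁)
    (hc₂ : 0 < c₂) (h1 : 𝕏.CondA1 ν t₀ c₁) (h2 : 𝕏.CondA2 ν c₂) :
    𝕏.toSemigroup.Doeblin ν t₀ c₁ c₂ where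
  surv_pos t x := by rw [← survival_pr]; exact hpos t x
  prob := inferInstance
  t₀_pos := ht₀
  c₁_pos := hc₁
  c₂_pos := hc₂
  minor x f hf hf0 := by
    have hs : ∀ t x, 0 < 𝕏.toSemigroup.surv t x := fun t x => by
      rw [← survival_pr]; exact hpos t x
    have hp := SubMarkovSemigroup.isProbabilityMeasure_cond hs (Measure.dirac x) t₀
    have h := h1 x
    rw [← prInit_dirac, condLaw_prInit] at h
    have := integral_mono_measure h (.of_forall hf0) (hf.integrable _)
    rw [integral_smul_measure, ENNReal.toReal_ofReal hc₁.le, smul_eq_mul] at this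
    rw [SubMarkovSemigroup.op_eq_surv_mul_integral_cond hs hf, mul_comm c₁, mul_assoc]
    exact mul_le_mul_of_nonneg_left this (hs t₀ x).le
  survive t x := by
    have := h2 t x
    rwa [survival_pr, survival_prInit] at this

lemma tvDist_le_iff {Φ Ψ : (E → ℝ) → ℝ} {r : ℝ} (hr : 0 ≤ r) :
    tvDist Φ Ψ ≤ ENNReal.ofReal r ↔
      ∀ f : E → ℝ, Measurable f → (∀ x, |f x| ≤ 1) → |Φ f - Ψ f| ≤ r := by
  simp only [tvDist, iSup_le_iff, ENNReal.ofReal_le_ofReal_iff hr, and_imp]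

/-- Both directions matter: one carries the constructed data to the process, the other makes the
estimates valid for any data given for the process. -/
lemma isSpectralData_iff {α : Measure E} {η : E → ℝ} {lam γ C C' C'' : ℝ} :
    𝕏.IsSpectralData α η lam γ C C' C'' ↔
      𝕏.toSemigroup.SpectralData α η lam γ C C' C'' := by
  constructor
  · intro D
    have := D.quasiStationary.1
    refine ⟨this, fun t => ?_, D.lam_pos, fun t => ?_, D.C_pos, D.γ_pos,
      fun μ hμ f hf hf1 t => ?_, D.η_bddMeas, D.η_nonneg, D.η_integral, fun x t => ?_,
      fun x t => ?_⟩
    · rw [← condLaw_prInit]; exact D.quasiStationary.2 t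
    · rw [← survival_prInit]; exact D.survival_eq t
    · have := (tvDist_le_iff (mul_pos D.C_pos (Real.exp_pos _)).le).1 (D.tv_le μ hμ t) f hf hf1
      rwa [condLaw_prInit] at this
    · rw [← survival_pr]; exact D.η_approx x t
    · rw [← survival_pr]; exact D.survival_le x t
  · intro D
    have := D.prob
    refine ⟨⟨this, fun t => ?_⟩, D.lam_pos, fun t => ?_, D.C_pos, D.γ_pos,
      fun μ hμ t => ?_, D.η_bddMeas, D.η_nonneg, D.η_integral, fun x t => ?_, fun x t => ?_⟩
    · rw [condLaw_prInit]; exact D.cond_eq t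
    · rw [survival_prInit]; exact D.integral_surv t
    · rw [tvDist_le_iff (mul_pos D.C_pos (Real.exp_pos _)).le, condLaw_prInit]
      exact fun f hf hf1 => D.tv_le μ hμ f hf hf1 t
    · rw [survival_pr]; exact D.η_approx x t
    · rw [survival_pr]; exact D.surv_le x t

end AbsorbedMarkovProcess

end

/-! ### The main theorem -/

theorem proposition2 {E Ω : Type*} [MeasurableSpace E] [MeasurableSpace Ω]
    (𝕏 : AbsorbedMarkovProcess E Ω)
    (hfin : ∀ x, ∀ᵐ ω ∂(𝕏.pr x), 𝕏.τ ω < ∞)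
    (hpos : ∀ (t : ℝ≥0) (x : E), 0 < 𝕏.survival (𝕏.pr x) t)
    (hA : ∃ (ν : Measure E) (t₀ : ℝ≥0) (c₁ c₂ : ℝ), IsProbabilityMeasure ν ∧
      0 < t₀ ∧ 0 < c₁ ∧ 0 < c₂ ∧ 𝕏.CondA1 ν t₀ c₁ ∧ 𝕏.CondA2 ν c₂) :
    -- the objects and constants of the statement exist
    (∃ (α : Measure E) (η : E → ℝ) (lam γ C C' C'' : ℝ), 𝕏.IsSpectralData α η lam γ C C' C'') ∧
    -- the Green operator is well defined and bounded, and its exponential series converges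
    (∃ K : ℝ, ∀ f : E → ℝ, IsBddMeas f →
      (∀ x, IntegrableOn (fun s : ℝ => 𝕏.semigroup s.toNNReal f x) (Set.Ioi 0)) ∧
      IsBddMeas (𝕏.green f) ∧ supNorm (𝕏.green f) ≤ K * supNorm f ∧
      ∀ (t : ℝ) (x : E), Summable (fun n : ℕ => t ^ n / (n.factorial : ℝ) * (𝕏.green^[n] f) x)) ∧
    -- the estimates, for any choice of these objects and constants
    ∀ (α : Measure E) (η : E → ℝ) (lam γ C C' C'' : ℝ), 𝕏.IsSpectralData α η lam γ C C' C'' →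
      (∀ μ : Measure E, IsProbabilityMeasure μ → ∀ f : E → ℝ, IsBddMeas f → ∀ n : ℕ, 1 ≤ n →
        |𝕏.greenPow μ n f - (∫ x, f x ∂α) * (∫ x, η x ∂μ) / lam ^ n| ≤
          (C * C'' + C') * supNorm f / (lam + γ) ^ n) ∧
      ∃ B : ℝ, ∀ μ : Measure E, IsProbabilityMeasure μ →
        0 < ∫ x, η x ∂μ ∧
        (∀ n : ℕ, 1 ≤ n → 0 < 𝕏.greenPow μ n 1 ∧
          tvDist (fun f => 𝕏.greenPow μ n f / 𝕏.greenPow μ n 1) (toForm α) ≤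
            ENNReal.ofReal (B / (∫ x, η x ∂μ) * (lam / (lam + γ)) ^ n)) ∧
        (∀ t : ℝ, 0 ≤ t → 0 < 𝕏.greenExp μ t 1 ∧
          tvDist (fun f => 𝕏.greenExp μ t f / 𝕏.greenExp μ t 1) (toForm α) ≤
            ENNReal.ofReal (B / (∫ x, η x ∂μ) * Real.exp (-t * (γ / (lam * (lam + γ)))))) := by
  obtain ⟨ν, t₀, c₁, c₂, hν, ht₀, hc₁, hc₂, h1, h2⟩ := hA
  have H := 𝕏.doeblin hpos ht₀ hc₁ hc₂ h1 h2
  have hs := H.surv_pos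
  simp only [𝕏.isSpectralData_iff]
  have hex := H.exists_spectralData (𝕏.tendsto_surv_zero hfin)
  refine ⟨hex, ?_, ?_⟩
  · obtain ⟨α, η, lam, γ, C, C', C'', D⟩ := hex
    -- The bound is the integral of `C'' exp (-λ₀ s)` over `s > 0`.
    refine ⟨C'' / lam, fun f hf => ?_⟩
    simp only [𝕏.semigroup_eq hf.1, 𝕏.green_eq hf.1, 𝕏.green_iterate_eq hf.1]
    exact ⟨D.integrableOn_op hf, D.isBddMeas_green hf,
      supNorm_le (mul_nonneg (div_pos D.C''_pos D.lam_pos).le (supNorm_nonneg f))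
        (D.abs_green_le hf.abs_le_supNorm), D.summable_exp hf⟩
  · intro α η lam γ C C' C'' D
    have hR : 0 ≤ 2 * (C * C'' + C') :=
      mul_nonneg zero_le_two (add_nonneg (mul_pos D.C_pos D.C''_pos).le D.C'_nonneg)
    have hlg := add_pos D.lam_pos D.γ_pos
    have hl := D.lam_pos
    -- The error constant for `‖f‖ ≤ 1`, doubled by the quotient estimate; it serves both normalized
    -- bounds.
    refine ⟨fun μ hμ f hf n _ => ?_, 2 * (C * C'' + C'), fun μ hμ => ?_⟩
    · rw [AbsorbedMarkovProcess.greenPow, 𝕏.green_iterate_eq hf.1]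
      exact D.abs_integral_iterate_sub_le μ hs hf hf.abs_le_supNorm n
    have hη := integral_pos_of_forall_pos D.η_bddMeas (D.η_pos H) μ
    refine ⟨hη, fun n _ => ?_, fun t ht => ?_⟩
    · simp only [AbsorbedMarkovProcess.greenPow, 𝕏.green_iterate_eq measurable_one]
      refine ⟨integral_pos_of_forall_pos (D.isBddMeas_iterate .one n) (D.iterate_one_pos hs n) μ,
        (AbsorbedMarkovProcess.tvDist_le_iff (by positivity)).2 fun f hf hf1 => ?_⟩
      rw [𝕏.green_iterate_eq hf]
      exact D.abs_normalized_iterate_sub_le μ hs hf hf1 n hη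
    · simp only [AbsorbedMarkovProcess.greenExp, 𝕏.expGreen_eq measurable_one]
      refine ⟨integral_pos_of_forall_pos (D.isBddMeas_expGreen .one t) (D.expGreen_one_pos hs ht) μ,
        (AbsorbedMarkovProcess.tvDist_le_iff (by positivity)).2 fun f hf hf1 => ?_⟩
      rw [𝕏.expGreen_eq hf]
      exact D.abs_normalized_exp_sub_le μ hs hf hf1 ht hη
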